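/- Let $A=\{a,b\}$. A code is a set $C\subseteq A^*$ such that $c_1\cdots c_h=c'_1\cdots c'_l$ with $c_i,c'_i\in C$ and $h,l\ge 0$ implies $h=l$ and $c_i=c'_i$ for all $i$; it is maximal if no code over $A$ properly contains it. For $m\in\mathbb N$, an $m$-code is a finite maximal code $C$ over $A$ such that every word of $C$ has at most $m$ occurrences of $b$ and some word of $C$ has exactly $m$. For $C\subseteq A^*$ let $C_r$ be the set of words of $C$ with exactly $r$ occurrences of $b$. In $\mathbb Z\langle A\rangle$ write $(P,w)$ for the coefficient of $w$ in $P$, $\mathrm{supp}(P)=\{w : (P,w)\neq 0\}$, $\underline X=\sum_{x\in X}x$ for a finite set $X$ of words, $P_g$ for the part of $P$ supported on the words with exactly $g$ occurrences of $b$, and $P\ge Q$ for coefficientwise inequality. For a finite (multi)set $H$ of nonnegative integers put $a^H=\sum_{h\in H}a^h$ (with multiplicity; $a^\emptyset=0$). A factorization of a finite maximal code $C$ is a pair $(P,S)$ in $\mathbb Z\langle A\rangle$ with $\underline C=P(\underline A-1)S+1$, where $\underline A=a+b$; it is positive if $P,S$ both have coefficients in $\{0,1\}$, or $-P,-S$ both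 do. A Krasner factorization of $\mathbb Z_n$, $n\ge 1$, is a pair $(I,J)$ of finite subsets of $\mathbb N$ with $a^Ia^J=1+a+\cdots+a^{n-1}$. Theorem. Let $(I,J)$ be a Krasner factorization of $\mathbb Z_n$, and let $P,S$ be polynomials in $\mathbb Z\langle A\rangle$ with nonnegative coefficients, where $S=a^J+\sum_{j\in J}a^{M_j}ba^j$ for finite multisets $M_j$ of nonnegative integers. Let $k\ge 0$, $P'=P_0+\cdots+P_k$ and $P=P'+P_{k+1}$ with $P_{k+1}\neq 0$. Then $(P,S)$ is a positive factorization of some $(k+3)$-code if and only if there are a finite set $C'$ of words and finite sets $L_z\subseteq\mathbb N$ such that the following conditions hold, where $Q_k=\{z\in A^* : \exists j\in J,\ zba^j\in C'_{k+1}\}$ and $J_z=\{j\in J : zba^j\in C'_{k+1}\}$ for $z\in Q_k$: (1) $C'$ is a $(k+t)$-code, where $t=2$ if $P_k\neq 0$ and $t=1$ otherwise, and $(P',S)$ is a positive factorization of $C'$; (2) $P_{k+1}=\sum_{z\in Q_k}zba^{L_z}$; (3) for all $z\in Q_k$, $$a^{L_z}(a-1)a^J+a^J\ \ge\ a^{L_z}(a-1)a^J+a^{J_z}\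 \ge\ 0,$$ and for all $j\in J$ and $z\in Q_k\setminus\mathrm{supp}(P_k)$, $$a^{L_z}(a-1)a^{M_j}+a^{L_z}\ \ge\ 0.$$ -/

import Mathlib

namespace FactorizingCodes

/-- The two-letter alphabet `A = {a, b}`. -/
inductive Letter where
  | a : Letter
  | b : Letter
  deriving DecidableEq

/-- The free monoid `A*`. -/
abbrev Word : Type := FreeMonoid Letter

instance : DecidableEq Word := inferInstanceAs (DecidableEq (List Letter))

/-- The word `a ^ i`. -/
def aWord (i : ℕ) : Word := FreeMonoid.of Letter.a ^ i

/-- The one-letter word `b`. -/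
def bWord : Word := FreeMonoid.of Letter.b

/-- The number `|w|_b` of occurrences of `b` in `w`. -/
def bCount (w : Word) : ℕ := (FreeMonoid.toList w).count Letter.b

/-! ### Codes -/

/-- A code over `A`: each word has at most one decomposition as a product of code words. -/
def IsCode (C : Set Word) : Prop :=
  InformationTheory.UniquelyDecodable (FreeMonoid.toList '' C)

/-- A finite maximal code: it is not properly contained in any (finite or infinite) code. -/
def IsFiniteMaximalCode (C : Finset Word) : Prop :=
  Maximal IsCode (C : Set Word)

/-- An `m`-code: a finite maximal code whose words have at most `m` occurrences of `b`, and one of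
whose words has exactly `m` of them. -/
def IsMCode (m : ℕ) (C : Finset Word) : Prop :=
  IsFiniteMaximalCode C ∧ (∀ w ∈ C, bCount w ≤ m) ∧ ∃ w ∈ C, bCount w = m

/-- The set `C_r` of the words of `C` with exactly `r` occurrences of `b`. -/
def wordsWith (C : Finset Word) (r : ℕ) : Finset Word := C.filter fun w => bCount w = r

/-! ### Noncommutative polynomials -/

/-- The ring `ℤ⟨A⟩` of polynomials in the noncommuting variables `a`, `b`; the coefficient of the
word `w` in `P` is `P.coeff w`. -/
abbrev NCPoly : Type := MonoidAlgebra ℤ Word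

/-- A word, seen as a polynomial. -/
noncomputable def mono (w : Word) : NCPoly := MonoidAlgebra.single w 1

/-- The variable `a`. -/
noncomputable def va : NCPoly := mono (aWord 1)

/-- The variable `b`. -/
noncomputable def vb : NCPoly := mono bWord

/-- `a ^ H = ∑_{h ∈ H} a ^ h` for a finite multiset `H` of natural numbers (counted with
multiplicity). -/
noncomputable def aPoly (H : Multiset ℕ) : NCPoly := (H.map fun h => mono (aWord h)).sum

/-- The characteristic polynomial of a finite set of words. -/
noncomputable def charPoly (X : Finset Word) : NCPoly := ∑ x ∈ X, mono x

/-- `P ≥ Q`, coefficientwise. -/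
def CoeffGE (P Q : NCPoly) : Prop := ∀ w : Word, Q.coeff w ≤ P.coeff w

/-- The part `P_g` of `P` that consists of the words with exactly `g` occurrences of `b`. -/
noncomputable def bPart (g : ℕ) (P : NCPoly) : NCPoly :=
  MonoidAlgebra.ofCoeff (P.coeff.filter fun w => bCount w = g)

/-- The polynomial `P` has coefficients `0, 1`. -/
def HasCoeffs01 (P : NCPoly) : Prop := ∀ w : Word, P.coeff w = 0 ∨ P.coeff w = 1

/-! ### Factorizations -/

/-- `(P, S)` is a factorization for the finite maximal code `C`: `C = P (A - 1) S + 1`. -/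
def IsFactorization (P S : NCPoly) (C : Finset Word) : Prop :=
  IsFiniteMaximalCode C ∧ charPoly C = P * (va + vb - 1) * S + 1

/-- `(P, S)` is a positive factorization for `C`. -/
def IsPositiveFactorization (P S : NCPoly) (C : Finset Word) : Prop :=
  IsFactorization P S C ∧
    ((HasCoeffs01 P ∧ HasCoeffs01 S) ∨ (HasCoeffs01 (-P) ∧ HasCoeffs01 (-S)))

/-- `(I, J)` is a Krasner factorization of the cyclic group `ℤ_n`, `n ≥ 1`:
`a ^ I * a ^ J = 1 + a + ⋯ + a ^ (n - 1)`. -/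
def IsKrasner (n : ℕ) (I J : Finset ℕ) : Prop :=
  0 < n ∧ aPoly I.val * aPoly J.val = aPoly (Multiset.range n)

/-- The polynomial `a ^ J + ∑_{j ∈ J} a ^ {M_j} b a ^ j`. -/
noncomputable def krasnerS (J : Finset ℕ) (M : ℕ → Multiset ℕ) : NCPoly :=
  aPoly J.val + ∑ j ∈ J, aPoly (M j) * vb * mono (aWord j)

/-- The index `t`: it is `2` if the given polynomial is nonzero, and `1` otherwise. -/
noncomputable def tIndex (R : NCPoly) : ℕ :=
  open Classical in if R ≠ 0 then 2 else 1

/-! ### The words `z` with `z b a ^ j ∈ D` -/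

/-- `{z | ∃ j ∈ J, z b a ^ j ∈ D}`. -/
def contextSet (J : Finset ℕ) (D : Finset Word) : Set Word :=
  {z | ∃ j ∈ J, z * bWord * aWord j ∈ D}

theorem contextSet_finite (J : Finset ℕ) (D : Finset Word) : (contextSet J D).Finite := by
  have h : contextSet J D = ⋃ j ∈ J, (fun z => z * bWord * aWord j) ⁻¹' (D : Set Word) := by
    ext z
    simp [contextSet]
  rw [h]
  refine Set.Finite.biUnion J.finite_toSet fun j _ => D.finite_toSet.preimage ?_
  intro x _ y _ hxy
  exact mul_right_cancel (mul_right_cancel hxy)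

/-- `contextSet J D` as a finite set; `Q_k` is `contexts J (C'_{k+1})`. -/
noncomputable def contexts (J : Finset ℕ) (D : Finset Word) : Finset Word :=
  (contextSet_finite J D).toFinset

/-- `J_z = {j ∈ J | z b a ^ j ∈ D}`. -/
def rightExps (J : Finset ℕ) (D : Finset Word) (z : Word) : Finset ℕ :=
  J.filter fun j => z * bWord * aWord j ∈ D

end FactorizingCodes

open FactorizingCodes

/-!
The polynomial `C = P (A - 1) S + 1` is read through its fibers over the last occurrence of `b`: the
one-variable polynomials formed by the coefficients at the words `a ^ t`, and at the words `w b a ^ t`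
for each word `w`. With `D_j = P + P (A - 1) a ^ {M_j}` (`bracket`), the first fiber of `C` is
`p_1 (X - 1) J + 1` and the fiber at `w` is `p_w (X - 1) J + ∑_{j ∈ J} (D_j, w) X ^ j`, where `p_1`, `p_w`
are the fibers of `P`; the fibers of `D_j` are `p_1 (1 + (X - 1) M_j)` and
`p_z (1 + (X - 1) M_j) + (P, z) M_j`. So nonnegativity of `C` is a family of conditions in one variable,
and the conditions for `P` and for `P'` differ only at words `w` with at least `k` occurrences of `b`.

Being a positive factorization reduces to nonnegativity (`exists_positiveFactorization`). If `P`, `S`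
and `C` are nonnegative and `C` has no constant term, then `S (1 + C + C ^ 2 + ⋯) P` is the series of all
words, so the coefficients of `P`, `S` and `∑ C ^ i` are at most `1` and `C` is a code. It is maximal by
the Kraft–McMillan inequality, its Kraft sum being `1` because `A - 1` vanishes at `a = b = 1 / 2`.

The one-variable arguments rest on one observation. The first fiber of a nonnegative `C` takes the value
`1` at `X = 1`, so it is a power `X ^ m`, and `p_1 J = 1 + ⋯ + X ^ (m - 1)`. If `(X ^ m - 1) Y + E ≥ 0` with
`deg E < m` and `m ≥ 1`, then the coefficients of `Y` do not increase along the residue classes modulo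
`m`, and so `Y ≥ 0`.

* Multiplying `p_w (X - 1) J + ∑ (D_j, w) X ^ j ≥ 0` by `p_1` gives `(D_j, w) ≥ 0` for all `w`
  (`nonneg_of_krasner`, `bracket_nonneg`). At the words `w` with `k` occurrences of `b` this says that the
  polynomial of `P'` is nonnegative; at those with `k + 1` occurrences it is the second condition on `L_z`
  for `z` outside the support of `P_k`.
* Conversely, when `z` lies in the support of `P_k`, nonnegativity of `L (X - 1) M + L + M` is needed for
  `L = a ^ {L_z}` and `M = a ^ {M_j}`. It follows from `L (X - 1) J + J ≥ 0` and `p_1 (1 + (X - 1) M) ≥ 0`,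
  as the product of the two left sides is
  `(X ^ m - 1) (L (X - 1) M + L + M) + (1 + ⋯ + X ^ (m - 1))` (`nonneg_comp_of_krasner`).
-/

namespace FactorizingCodes

/-! ### Nonnegative polynomials -/

theorem coeffGE_iff_sub {Y Z : NCPoly} : CoeffGE Y Z ↔ CoeffGE (Y - Z) 0 := by
  simp [CoeffGE]

theorem CoeffGE.add_nonneg {Y Z : NCPoly} (hY : CoeffGE Y 0) (hZ : CoeffGE Z 0) :
    CoeffGE (Y + Z) 0 := fun w => by
  have h1 := hY w
  have h2 := hZ w
  simp at *
  omega

theorem CoeffGE.mul_nonneg {Y Z : NCPoly} (hY : CoeffGE Y 0) (hZ : CoeffGE Z 0) :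
    CoeffGE (Y * Z) 0 := fun w => by
  rw [MonoidAlgebra.coeff_mul]
  refine Finset.sum_nonneg fun u _ => Finset.sum_nonneg fun v _ => ?_
  dsimp only
  split_ifs
  · exact Int.mul_nonneg (hY u) (hZ v)
  · exact le_rfl

theorem coeff_mono (u w : Word) : (mono u).coeff w = if u = w then 1 else 0 := by
  rw [mono, MonoidAlgebra.coeff_single, Finsupp.single_apply]

theorem mono_nonneg (u : Word) : CoeffGE (mono u) 0 := fun w => by
  rw [coeff_mono]; split_ifs <;> simp

theorem coeffGE_one_zero : CoeffGE (1 : NCPoly) 0 := mono_nonneg 1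

theorem coeff_one_apply (w : Word) : (1 : NCPoly).coeff w = if w = 1 then 1 else 0 := by
  rw [show (1 : NCPoly) = mono 1 from rfl, coeff_mono]
  simp [eq_comm]

theorem mono_mul_mono (u v : Word) : mono u * mono v = mono (u * v) := by
  simp [mono]

theorem coeff_mono_mul (u v : Word) (Y : NCPoly) : (mono u * Y).coeff (u * v) = Y.coeff v := by
  rw [mono, MonoidAlgebra.coeff_single_mul_eq_mul_coeff v (by simp), one_mul]

theorem coeff_mul_mono (u v : Word) (Y : NCPoly) : (Y * mono v).coeff (u * v) = Y.coeff u := by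
  rw [mono, MonoidAlgebra.coeff_mul_single_eq_coeff_mul u (by simp), mul_one]

theorem coeff_one_mul_one (Y Z : NCPoly) : (Y * Z).coeff 1 = Y.coeff 1 * Z.coeff 1 := by
  refine (MonoidAlgebra.coeff_mul_antidiag Y Z 1 {(1, 1)} ?_).trans (by simp)
  rintro ⟨u, v⟩
  simp [Prod.ext_iff]

theorem sub_one_nonneg {Y : NCPoly} (hY : CoeffGE Y 0) (h : Y.coeff 1 = 1) : CoeffGE (Y - 1) 0 := by
  intro w
  have := hY w
  by_cases hw : w = 1
  · subst hw; simp [h]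
  · simpa [coeff_one_apply, hw] using this

theorem coeff_charPoly (X : Finset Word) (w : Word) :
    (charPoly X).coeff w = if w ∈ X then 1 else 0 := by
  rw [charPoly, MonoidAlgebra.coeff_sum, Finsupp.finsetSum_apply]
  simp [coeff_mono]

theorem charPoly_nonneg (X : Finset Word) : CoeffGE (charPoly X) 0 := fun w => by
  rw [coeff_charPoly]; split_ifs <;> simp

/-- The support of a polynomial with coefficients `0, 1` is a set of words whose characteristic
polynomial it is. -/
theorem charPoly_support {Y : NCPoly} (h : HasCoeffs01 Y) : charPoly Y.coeff.support = Y := by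
  ext w
  rw [coeff_charPoly]
  rcases h w with h | h <;> simp [h]

/-! ### The order filtration -/

/-- The polynomial `Y` has no words of length less than `N`. -/
def VanishesBelow (N : ℕ) (Y : NCPoly) : Prop := ∀ w : Word, w.length < N → Y.coeff w = 0

theorem VanishesBelow.add {N : ℕ} {Y Z : NCPoly} (hY : VanishesBelow N Y)
    (hZ : VanishesBelow N Z) : VanishesBelow N (Y + Z) := fun w hw => by
  simp [hY w hw, hZ w hw]

theorem VanishesBelow.mono {N K : ℕ} {Y : NCPoly} (hY : VanishesBelow N Y) (h : K ≤ N) :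
    VanishesBelow K Y := fun w hw => hY w (hw.trans_le h)

theorem VanishesBelow.mul {N K : ℕ} {Y Z : NCPoly} (hY : VanishesBelow N Y)
    (hZ : VanishesBelow K Z) : VanishesBelow (N + K) (Y * Z) := fun w hw => by
  rw [MonoidAlgebra.coeff_mul]
  refine Finset.sum_eq_zero fun u _ => Finset.sum_eq_zero fun v _ => ?_
  dsimp only
  split_ifs with h
  · subst h
    rw [FreeMonoid.length_mul] at hw
    by_cases hu : u.length < N
    · rw [hY u hu, zero_mul]
    · rw [hZ v (by omega), mul_zero]
  · rfl

theorem vanishesBelow_zero (Y : NCPoly) : VanishesBelow 0 Y := fun _ hw => absurd hw (by simp)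

theorem vanishesBelow_one {Y : NCPoly} (h : Y.coeff 1 = 0) : VanishesBelow 1 Y := fun w hw => by
  rw [Nat.lt_one_iff, FreeMonoid.length_eq_zero] at hw
  rwa [hw]

theorem VanishesBelow.pow {Y : NCPoly} (hY : VanishesBelow 1 Y) (N : ℕ) :
    VanishesBelow N (Y ^ N) := by
  induction N with
  | zero => exact vanishesBelow_zero _
  | succ N ih => rw [pow_succ]; exact ih.mul hY

/-- A polynomial with constant term `1` is invertible as a power series, hence cancels. -/
theorem VanishesBelow.of_mul {N : ℕ} {Y Z : NCPoly} (hY : Y.coeff 1 = 1)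
    (h : VanishesBelow N (Y * Z)) : VanishesBelow N Z := by
  suffices ∀ K ≤ N, VanishesBelow K Z from this N le_rfl
  intro K
  induction K with
  | zero => exact fun _ => vanishesBelow_zero _
  | succ K ih =>
    intro hK
    have h1 : VanishesBelow 1 (1 - Y) := vanishesBelow_one (by simp [hY])
    have h2 := (h1.mul (ih (by omega))).mono (K := K + 1) (by omega)
    have h3 := h2.add (h.mono hK)
    rwa [show (1 - Y) * Z + Y * Z = Z by noncomm_ring] at h3

/-- A solution of `(1 - A) Y = 1` modulo words of length at least `N` agrees there with the series
of all words. -/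
theorem coeff_eq_one_of_geometric {N : ℕ} {Y : NCPoly}
    (h : VanishesBelow N ((va + vb - 1) * Y + 1)) (w : Word) (hw : w.length < N) :
    Y.coeff w = 1 := by
  have key : ∀ w : Word, w.length < N → (va * Y).coeff w + (vb * Y).coeff w + (1 : NCPoly).coeff w
      = Y.coeff w := by
    intro w hw
    have := h w hw
    rw [show (va + vb - 1) * Y + 1 = va * Y + vb * Y - Y + 1 by noncomm_ring] at this
    simp only [MonoidAlgebra.coeff_add, MonoidAlgebra.coeff_sub, Finsupp.add_apply,
      Finsupp.sub_apply] at this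
    linarith
  have hva : va = mono (FreeMonoid.of Letter.a) := by simp [va, aWord]
  have hvb : vb = mono (FreeMonoid.of Letter.b) := rfl
  have hne : ∀ (x : Letter) (u : Word), FreeMonoid.of x * u ≠ 1 := by
    intro x u hu
    have := congrArg FreeMonoid.length hu
    simp at this
  have hne2 : ∀ (x y : Letter) (u v : Word), x ≠ y →
      FreeMonoid.of x * u ≠ FreeMonoid.of y * v := by
    intro x y u v hxy hu
    have := congrArg FreeMonoid.toList hu
    simp at this
    exact hxy this.1
  induction w using FreeMonoid.inductionOn' with
  | one =>
    rw [← key 1 hw, hva, hvb, mono, mono, MonoidAlgebra.coeff_single_mul_of_forall_mul_ne _ _ (hne _),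
      MonoidAlgebra.coeff_single_mul_of_forall_mul_ne _ _ (hne _)]
    simp
  | of_mul x w ih =>
    have hw' : w.length < N := by
      rw [FreeMonoid.length_mul] at hw
      omega
    rw [← key _ hw, coeff_one_apply, if_neg (hne _ _), ← ih hw', hva, hvb]
    cases x
    · rw [coeff_mono_mul, mono, MonoidAlgebra.coeff_single_mul_of_forall_mul_ne _ _
        (fun d => hne2 _ _ _ _ (by simp))]
      simp
    · rw [coeff_mono_mul, mono, MonoidAlgebra.coeff_single_mul_of_forall_mul_ne _ _
        (fun d => hne2 _ _ _ _ (by simp))]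
      simp

/-! ### Positive factorizations give finite maximal codes -/

theorem geomSum_nonneg {Y : NCPoly} (hY : CoeffGE Y 0) (N : ℕ) :
    CoeffGE (∑ i ∈ Finset.range N, Y ^ i) 0 := by
  induction N with
  | zero => simp [CoeffGE]
  | succ N ih =>
    rw [Finset.sum_range_succ']
    have : ∑ i ∈ Finset.range N, Y ^ (i + 1) = Y * ∑ i ∈ Finset.range N, Y ^ i := by
      simp [Finset.mul_sum, pow_succ']
    rw [this, pow_zero]
    exact (hY.mul_nonneg ih).add_nonneg coeffGE_one_zero

/-- If `C = P (A - 1) S + 1` has no constant term, then `S (1 + C + ⋯ + C ^ (N - 1)) P` contains each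
word of length less than `N` exactly once. -/
theorem coeff_mul_geomSum_mul {P S C : NCPoly} (hC : C = P * (va + vb - 1) * S + 1)
    (hP : P.coeff 1 = 1) (hC1 : C.coeff 1 = 0) {N : ℕ} {w : Word} (hw : w.length < N) :
    (S * (∑ i ∈ Finset.range N, C ^ i) * P).coeff w = 1 := by
  set T := ∑ i ∈ Finset.range N, C ^ i with hT
  refine coeff_eq_one_of_geometric (VanishesBelow.of_mul hP ?_) w hw
  have h1 : (C - 1) * T = C ^ N - 1 := mul_geom_sum C N
  have h2 : C - 1 = P * (va + vb - 1) * S := by rw [hC]; noncomm_ring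
  rw [show P * ((va + vb - 1) * (S * T * P) + 1) = (P * (va + vb - 1) * S) * T * P + P by
    noncomm_ring, ← h2, h1, show (C ^ N - 1) * P + P = C ^ N * P by noncomm_ring]
  exact ((vanishesBelow_one hC1).pow N).mul (vanishesBelow_zero P)

theorem constCoeff_eq_one {P S C : NCPoly} (hC : C = P * (va + vb - 1) * S + 1)
    (hP : CoeffGE P 0) (hS : CoeffGE S 0) (hC1 : C.coeff 1 = 0) :
    P.coeff 1 = 1 ∧ S.coeff 1 = 1 := by
  have h : P.coeff 1 * S.coeff 1 = 1 := by
    have h0 : (va + vb - 1 : NCPoly).coeff 1 = -1 := by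
      have h1 : aWord 1 ≠ 1 := by
        intro h
        simpa [aWord] using congrArg FreeMonoid.length h
      have h2 : bWord ≠ 1 := by
        intro h
        simpa [bWord] using congrArg FreeMonoid.length h
      simp [va, vb, coeff_mono, h1, h2]
    rw [hC, MonoidAlgebra.coeff_add, Finsupp.add_apply, coeff_one_mul_one, coeff_one_mul_one, h0,
      MonoidAlgebra.coeff_one_one] at hC1
    linarith
  have hp : 0 ≤ P.coeff 1 := hP 1
  have hs : 0 ≤ S.coeff 1 := hS 1
  rcases Int.mul_eq_one_iff_eq_one_or_neg_one.1 h with h | h <;> omega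

/-- If the sums of powers of `charPoly C` have coefficients at most `1`, then `C` is a code: two
words of `C` beginning two factorizations of one word would contribute twice. -/
theorem isCode_of_coeff_geomSum_le (C : Finset Word) (h1 : (1 : Word) ∉ C)
    (h : ∀ N : ℕ, ∀ w : Word, w.length < N →
      (∑ i ∈ Finset.range N, charPoly C ^ i).coeff w ≤ 1) :
    IsCode (C : Set Word) := by
  set T : ℕ → NCPoly := fun N => ∑ i ∈ Finset.range N, charPoly C ^ i with hT
  have hrec : ∀ N, T (N + 1) = 1 + charPoly C * T N := by
    intro N
    simp only [hT, Finset.sum_range_succ', Finset.mul_sum, pow_succ', pow_zero, add_comm]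
  have hTn : ∀ N, CoeffGE (T N) 0 := geomSum_nonneg (charPoly_nonneg C)
  have hone : ∀ c ∈ C, ∀ N v, (T N).coeff v ≤ (T (N + 1)).coeff (c * v) := by
    intro c hc N v
    have h3 : charPoly C * T N = mono c * T N + charPoly (C.erase c) * T N := by
      rw [← add_mul, charPoly, charPoly, Finset.add_sum_erase _ _ hc]
    have h4 := coeffGE_one_zero (c * v)
    have h5 := ((charPoly_nonneg (C.erase c)).mul_nonneg (hTn N)) (c * v)
    rw [hrec, h3]
    simp only [MonoidAlgebra.coeff_add, Finsupp.add_apply, coeff_mono_mul,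
      MonoidAlgebra.coeff_zero, Finsupp.coe_zero, Pi.zero_apply] at *
    omega
  have hlist : ∀ (L : List Word), (∀ c ∈ L, c ∈ C) → ∀ N, L.length < N → 1 ≤ (T N).coeff L.prod := by
    intro L
    induction L with
    | nil =>
      intro _ N hN
      obtain ⟨K, rfl⟩ : ∃ K, N = K + 1 := ⟨N - 1, by simp at hN; omega⟩
      have h5 := ((charPoly_nonneg C).mul_nonneg (hTn K)) 1
      rw [hrec]
      simp only [MonoidAlgebra.coeff_add, Finsupp.add_apply, List.prod_nil,
        MonoidAlgebra.coeff_zero, Finsupp.coe_zero, Pi.zero_apply, MonoidAlgebra.coeff_one_one] at *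
      omega
    | cons c L ih =>
      intro hL N hN
      obtain ⟨K, rfl⟩ : ∃ K, N = K + 1 := ⟨N - 1, by simp at hN; omega⟩
      rw [List.prod_cons]
      exact (ih (fun c hc => hL c (by simp [hc])) K (by simpa using hN)).trans
        (hone c (hL c (by simp)) K _)
  have hne : ∀ c ∈ C, ∀ v : Word, c * v ≠ 1 := by
    intro c hc v hv
    have := congrArg FreeMonoid.length hv
    rw [FreeMonoid.length_mul, FreeMonoid.length_one] at this
    have h0 : c = 1 := FreeMonoid.length_eq_zero.1 (by omega)
    exact h1 (h0 ▸ hc)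
  have main : ∀ (L₁ L₂ : List Word), (∀ c ∈ L₁, c ∈ C) → (∀ c ∈ L₂, c ∈ C) →
      L₁.prod = L₂.prod → L₁ = L₂ := by
    intro L₁
    induction L₁ with
    | nil =>
      intro L₂ _ h₂ he
      cases L₂ with
      | nil => rfl
      | cons d L₂ =>
        rw [List.prod_nil, List.prod_cons] at he
        exact absurd he.symm (hne d (h₂ d (by simp)) _)
    | cons c L₁ ih =>
      intro L₂ h₁ h₂ he
      cases L₂ with
      | nil =>
        rw [List.prod_nil, List.prod_cons] at he
        exact absurd he (hne c (h₁ c (by simp)) _)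
      | cons d L₂ =>
        rw [List.prod_cons, List.prod_cons] at he
        have hc := h₁ c (by simp)
        have hd := h₂ d (by simp)
        by_cases hcd : c = d
        · subst hcd
          rw [ih L₂ (fun x hx => h₁ x (by simp [hx])) (fun x hx => h₂ x (by simp [hx]))
            (mul_left_cancel he)]
        · exfalso
          set N := L₁.length + L₂.length + (c * L₁.prod).length + 1 with hN
          have e1 := hlist L₁ (fun x hx => h₁ x (by simp [hx])) N (by omega)
          have e2 := hlist L₂ (fun x hx => h₂ x (by simp [hx])) N (by omega)
          have e3 := h (N + 1) (c * L₁.prod) (by omega)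
          have h3 : charPoly C * T N = mono c * T N + (mono d * T N
              + charPoly ((C.erase c).erase d) * T N) := by
            rw [← add_mul, ← add_mul, charPoly, charPoly, Finset.add_sum_erase _ _
              (Finset.mem_erase.2 ⟨Ne.symm hcd, hd⟩), Finset.add_sum_erase _ _ hc]
          have h4 := coeffGE_one_zero (c * L₁.prod)
          have h5 := ((charPoly_nonneg ((C.erase c).erase d)).mul_nonneg (hTn N)) (c * L₁.prod)
          have e4 : (mono d * T N).coeff (c * L₁.prod) = (T N).coeff L₂.prod := by
            rw [he, coeff_mono_mul]
          change (T (N + 1)).coeff _ ≤ 1 at e3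
          rw [hrec, h3] at e3
          simp only [MonoidAlgebra.coeff_add, Finsupp.add_apply, coeff_mono_mul,
            MonoidAlgebra.coeff_zero, Finsupp.coe_zero, Pi.zero_apply] at *
          omega
  have hflat : ∀ L : List (List Letter),
      L.flatten = FreeMonoid.toList (L.map FreeMonoid.ofList).prod := by
    intro L
    induction L with
    | nil => rfl
    | cons x L ih => rw [List.flatten_cons, ih, List.map_cons, List.prod_cons]; rfl
  have hmem : ∀ L : List (List Letter), (∀ w ∈ L, w ∈ FreeMonoid.toList '' (C : Set Word)) →
      ∀ c ∈ L.map FreeMonoid.ofList, c ∈ C := by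
    intro L hL c hc
    obtain ⟨x, hx, rfl⟩ := List.mem_map.1 hc
    obtain ⟨y, hy, rfl⟩ := hL x hx
    exact hy
  intro L₁ L₂ h₁ h₂ he
  rw [hflat, hflat] at he
  exact List.map_injective_iff.2 FreeMonoid.ofList.injective
    (main _ _ (hmem _ h₁) (hmem _ h₂) (FreeMonoid.toList.injective he))

theorem IsCode.one_notMem {C : Set Word} (hC : IsCode C) : (1 : Word) ∉ C := fun h =>
  hC.epsilon_not_mem ⟨1, h, rfl⟩

instance instFintypeLetter : Fintype Letter := ⟨{Letter.a, Letter.b}, fun x => by cases x <;> simp⟩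

/-- The Kraft–McMillan inequality for codes over `{a, b}`. -/
theorem IsCode.kraft {C : Finset Word} (hC : IsCode (C : Set Word)) :
    ∑ w ∈ C, (1 / 2 : ℝ) ^ w.length ≤ 1 := by
  have hn : Nonempty Letter := ⟨Letter.a⟩
  have h := InformationTheory.kraft_mcmillan_inequality (α := Letter)
    (S := C.image FreeMonoid.toList) (by rw [Finset.coe_image]; exact hC)
  rw [Finset.sum_image (fun x _ y _ hxy => FreeMonoid.toList.injective hxy)] at h
  have hcard : Fintype.card Letter = 2 := rfl
  rw [hcard] at h
  exact_mod_cast h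

/-- The evaluation of polynomials at `a = b = 1 / 2`. -/
noncomputable def evalHalf : NCPoly →+* ℝ :=
  (MonoidAlgebra.lift ℤ ℝ Word (FreeMonoid.lift fun _ : Letter => (1 / 2 : ℝ))).toRingHom

theorem evalHalf_mono (w : Word) : evalHalf (mono w) = (1 / 2 : ℝ) ^ w.length := by
  have h : evalHalf (mono w) = FreeMonoid.lift (fun _ : Letter => (1 / 2 : ℝ)) w := by
    simp [evalHalf, mono]
  rw [h, FreeMonoid.lift_apply]
  simp [FreeMonoid.length]

/-- A code `C` with `C - 1 ∈ ℤ⟨A⟩ (A - 1) ℤ⟨A⟩` has Kraft sum `1`, so no code contains it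
properly. -/
theorem isFiniteMaximalCode_of_factorization {P S : NCPoly} {C : Finset Word}
    (hcode : IsCode (C : Set Word)) (hC : charPoly C = P * (va + vb - 1) * S + 1) :
    IsFiniteMaximalCode C := by
  refine ⟨hcode, fun D hD hCD w hw => ?_⟩
  by_contra hwC
  have hwC' : w ∉ C := hwC
  have hsum : ∑ w ∈ C, (1 / 2 : ℝ) ^ w.length = 1 := by
    have h := congrArg evalHalf hC
    have hA : evalHalf (va + vb - 1) = 0 := by
      rw [map_sub, map_add, va, vb, evalHalf_mono, evalHalf_mono, map_one]
      norm_num [aWord, bWord]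
    rw [map_add, map_mul, map_mul, hA, mul_zero, zero_mul, zero_add, map_one, charPoly,
      map_sum] at h
    simpa only [evalHalf_mono] using h
  have hins : IsCode ((insert w C : Finset Word) : Set Word) := by
    have hsub : ((insert w C : Finset Word) : Set Word) ⊆ D := by
      rw [Finset.coe_insert]
      exact Set.insert_subset hw hCD
    intro L₁ L₂ h₁ h₂ he
    exact hD L₁ L₂ (fun x hx => Set.image_mono hsub (h₁ x hx))
      (fun x hx => Set.image_mono hsub (h₂ x hx)) he
  have hk := hins.kraft
  rw [Finset.sum_insert hwC', hsum] at hk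
  have : (0 : ℝ) < (1 / 2 : ℝ) ^ w.length := by positivity
  linarith

/-- Nonnegative `P, S` for which `C = P (A - 1) S + 1` is nonnegative without constant term are a
positive factorization of a finite maximal code. -/
theorem exists_positiveFactorization {P S C : NCPoly} (hC : C = P * (va + vb - 1) * S + 1)
    (hP : CoeffGE P 0) (hS : CoeffGE S 0) (hC0 : CoeffGE C 0) (hC1 : C.coeff 1 = 0) :
    ∃ X : Finset Word, charPoly X = C ∧ IsFiniteMaximalCode X ∧ IsPositiveFactorization P S X := by
  obtain ⟨hP1, hS1⟩ := constCoeff_eq_one hC hP hS hC1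
  have hPm := sub_one_nonneg hP hP1
  have hSm := sub_one_nonneg hS hS1
  set T : ℕ → NCPoly := fun N => ∑ i ∈ Finset.range N, C ^ i with hT
  have hrec : ∀ N, T (N + 1) = 1 + C * T N := by
    intro N
    simp only [hT, Finset.sum_range_succ', Finset.mul_sum, pow_succ', pow_zero, add_comm]
  have hTn : ∀ N, CoeffGE (T N) 0 := geomSum_nonneg hC0
  have hTm : ∀ N, CoeffGE (T (N + 1) - 1) 0 := by
    intro N
    rw [hrec, add_sub_cancel_left]
    exact hC0.mul_nonneg (hTn N)
  have hle : ∀ {Y : NCPoly} {w : Word} {N : ℕ}, w.length < N →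
      CoeffGE (S * T N * P - Y) 0 → Y.coeff w ≤ 1 := by
    intro Y w N hw h
    have h1 := h w
    have h2 := coeff_mul_geomSum_mul hC hP1 hC1 hw
    change (S * T N * P).coeff w = 1 at h2
    simp only [MonoidAlgebra.coeff_sub, Finsupp.sub_apply, h2, MonoidAlgebra.coeff_zero,
      Finsupp.coe_zero, Pi.zero_apply] at h1
    omega
  have hTle : ∀ N, ∀ w : Word, w.length < N → (T N).coeff w ≤ 1 := by
    intro N w hw
    refine hle hw ?_
    rw [show S * T N * P - T N = (S - 1) * T N * P + T N * (P - 1) by noncomm_ring]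
    exact ((hSm.mul_nonneg (hTn N)).mul_nonneg hP).add_nonneg ((hTn N).mul_nonneg hPm)
  have h01 : ∀ {Y : NCPoly}, CoeffGE Y 0 → (∀ w, Y.coeff w ≤ 1) → HasCoeffs01 Y := by
    intro Y h0 h1 w
    have h2 : 0 ≤ Y.coeff w := h0 w
    have h3 := h1 w
    omega
  have hP01 : HasCoeffs01 P := h01 hP fun w => by
    refine hle (Nat.lt_succ_self w.length) ?_
    rw [show S * T (w.length + 1) * P - P =
      (S - 1) * T (w.length + 1) * P + (T (w.length + 1) - 1) * P by noncomm_ring]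
    exact ((hSm.mul_nonneg (hTn _)).mul_nonneg hP).add_nonneg ((hTm _).mul_nonneg hP)
  have hS01 : HasCoeffs01 S := h01 hS fun w => by
    refine hle (Nat.lt_succ_self w.length) ?_
    rw [show S * T (w.length + 1) * P - S =
      S * T (w.length + 1) * (P - 1) + S * (T (w.length + 1) - 1) by noncomm_ring]
    exact ((hS.mul_nonneg (hTn _)).mul_nonneg hPm).add_nonneg (hS.mul_nonneg (hTm _))
  have hC01 : HasCoeffs01 C := h01 hC0 fun w => by
    have h1 := hTle (w.length + 2) w (by omega)
    have h2 : T (w.length + 2) = C + (1 + C * (T (w.length + 1) - 1)) := by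
      rw [hrec]; noncomm_ring
    have h3 := (coeffGE_one_zero.add_nonneg (hC0.mul_nonneg (hTm w.length))) w
    rw [h2, MonoidAlgebra.coeff_add, Finsupp.add_apply] at h1
    rw [MonoidAlgebra.coeff_zero, Finsupp.coe_zero, Pi.zero_apply] at h3
    omega
  have hX := charPoly_support hC01
  have hcode : IsCode (C.coeff.support : Set Word) :=
    isCode_of_coeff_geomSum_le _ (by simp [hC1]) (by simpa only [hX] using hTle)
  have hmax := isFiniteMaximalCode_of_factorization hcode (hX.trans hC)
  exact ⟨_, hX, hmax, ⟨hmax, hX.trans hC⟩, Or.inl ⟨hP01, hS01⟩⟩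

open Polynomial

/-! ### Nonnegative polynomials in one variable -/

/-- The coefficients of the one-variable polynomial `p` are nonnegative. -/
def NonnegCoeffs (p : ℤ[X]) : Prop := ∀ s, 0 ≤ p.coeff s

theorem NonnegCoeffs.add {p q : ℤ[X]} (hp : NonnegCoeffs p) (hq : NonnegCoeffs q) :
    NonnegCoeffs (p + q) := fun s => by
  rw [coeff_add]; exact add_nonneg (hp s) (hq s)

theorem NonnegCoeffs.mul {p q : ℤ[X]} (hp : NonnegCoeffs p) (hq : NonnegCoeffs q) :
    NonnegCoeffs (p * q) := fun s => by
  rw [coeff_mul]; exact Finset.sum_nonneg fun x _ => mul_nonneg (hp _) (hq _)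

theorem nonnegCoeffs_zero : NonnegCoeffs 0 := fun s => by simp

theorem NonnegCoeffs.eq_zero_of_eval_one {p : ℤ[X]} (hp : NonnegCoeffs p) (h : p.eval 1 = 0) :
    p = 0 := by
  rw [eval_eq_sum, Polynomial.sum, Finset.sum_eq_zero_iff_of_nonneg
    (fun s _ => by simpa using hp s)] at h
  ext s
  by_cases hs : s ∈ p.support
  · simpa using h s hs
  · simpa using hs

theorem NonnegCoeffs.eq_X_pow {p : ℤ[X]} (hp : NonnegCoeffs p) (h : p.eval 1 = 1) :
    ∃ m, p = X ^ m := by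
  have hne : p ≠ 0 := by rintro rfl; simp at h
  obtain ⟨m, hm⟩ := nonempty_support_iff.2 hne
  have h1 : 0 < p.coeff m := lt_of_le_of_ne (hp m) (Ne.symm (mem_support_iff.1 hm))
  have hq : NonnegCoeffs (p - X ^ m) := fun s => by
    rw [coeff_sub, coeff_X_pow]
    split_ifs with hs
    · subst hs; omega
    · simpa using hp s
  exact ⟨m, sub_eq_zero.1 (hq.eq_zero_of_eval_one (by simp [h]))⟩

/-- If `(X ^ m - 1) Y + E` is nonnegative and `E` has degree less than `m`, then the coefficients of
`Y` are nonincreasing along each residue class modulo `m`. -/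
theorem coeff_add_le_coeff {m : ℕ} {Y E : ℤ[X]} (h : NonnegCoeffs ((X ^ m - 1) * Y + E))
    (hE : ∀ s, m ≤ s → E.coeff s = 0) (s : ℕ) : Y.coeff (s + m) ≤ Y.coeff s := by
  have h1 := h (s + m)
  rw [sub_mul, one_mul, coeff_add, coeff_sub, coeff_X_pow_mul, hE _ (by omega)] at h1
  omega

/-- The bound by `E` at the start of each residue class, complementing `coeff_add_le_coeff`. -/
theorem coeff_le_coeff {m : ℕ} {Y E : ℤ[X]} (h : NonnegCoeffs ((X ^ m - 1) * Y + E)) {s : ℕ}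
    (hs : s < m) : Y.coeff s ≤ E.coeff s := by
  have h1 := h s
  rw [sub_mul, one_mul, coeff_add, coeff_sub, coeff_X_pow_mul', if_neg (by omega)] at h1
  omega

/-- A polynomial whose coefficients are nonincreasing along residue classes is nonnegative, as the
coefficients vanish eventually. -/
theorem nonnegCoeffs_of_column {m : ℕ} (hm : 0 < m) {Y E : ℤ[X]}
    (h : NonnegCoeffs ((X ^ m - 1) * Y + E)) (hE : ∀ s, m ≤ s → E.coeff s = 0) :
    NonnegCoeffs Y := by
  intro s
  have h1 : ∀ t, Y.coeff (s + t * m) ≤ Y.coeff s := by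
    intro t
    induction t with
    | zero => simp
    | succ t ih =>
      have := coeff_add_le_coeff h hE (s + t * m)
      rw [show s + (t + 1) * m = s + t * m + m by ring]
      exact this.trans ih
  have h2 := h1 (Y.natDegree + 1)
  rwa [coeff_eq_zero_of_natDegree_lt] at h2
  nlinarith

/-! ### Krasner factorizations -/

/-- The polynomial `∑_{h ∈ H} X ^ h` of a finite multiset `H` of natural numbers. -/
noncomputable def expPoly (H : Multiset ℕ) : ℤ[X] := (H.map fun h => X ^ h).sum

theorem coeff_expPoly (H : Multiset ℕ) (s : ℕ) : (expPoly H).coeff s = H.count s := by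
  induction H using Multiset.induction_on with
  | empty => simp [expPoly]
  | cons h H ih =>
    rw [expPoly, Multiset.map_cons, Multiset.sum_cons, coeff_add, ← expPoly, ih, coeff_X_pow,
      Multiset.count_cons]
    split_ifs <;> push_cast <;> ring

theorem coeff_expPoly_val (H : Finset ℕ) (s : ℕ) :
    (expPoly H.val).coeff s = if s ∈ H then 1 else 0 := by
  rw [coeff_expPoly, Multiset.count_eq_of_nodup H.nodup]
  simp

theorem expPoly_nonneg (H : Multiset ℕ) : NonnegCoeffs (expPoly H) := fun s => by
  rw [coeff_expPoly]; positivity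

theorem expPoly_val (J : Finset ℕ) : expPoly J.val = ∑ j ∈ J, X ^ j := rfl

theorem mul_eq_geomSum {m : ℕ} {p q : ℤ[X]} (h : p * (X - 1) * q + 1 = X ^ m) :
    p * q = ∑ i ∈ Finset.range m, X ^ i := by
  have h1 : (X - 1 : ℤ[X]) ≠ 0 := X_sub_C_ne_zero (1 : ℤ)
  refine mul_right_cancel₀ h1 ?_
  rw [geom_sum_mul, ← h]
  ring

theorem coeff_geomSum (m s : ℕ) :
    (∑ i ∈ Finset.range m, (X : ℤ[X]) ^ i).coeff s = if s < m then 1 else 0 := by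
  simp [finsetSum_coeff, coeff_X_pow]

/-- Let `I J = 1 + ⋯ + X ^ (m - 1)` and let `d = ∑_{j ∈ J} d_j X ^ j`. As the sums of an exponent of
`I` and one of `J` are distinct, `d I` has degree less than `m` and coefficient `d_j` at `X ^ j`. -/
theorem coeff_sum_mul_of_krasner {m : ℕ} {p : ℤ[X]} {J : Finset ℕ} (hp : NonnegCoeffs p)
    (hp0 : p.coeff 0 = 1) (h : p * (X - 1) * expPoly J.val + 1 = X ^ m) (d : ℕ → ℤ) :
    (∀ s, m ≤ s → ((∑ j ∈ J, C (d j) * X ^ j) * p).coeff s = 0) ∧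
      ∀ j ∈ J, j < m ∧ ((∑ j ∈ J, C (d j) * X ^ j) * p).coeff j = d j := by
  have h1 : ∀ (d : ℕ → ℤ) (s : ℕ), ((∑ j ∈ J, C (d j) * X ^ j) * p).coeff s =
      ∑ j ∈ J, d j * (X ^ j * p).coeff s := by
    intro d s
    simp [Finset.sum_mul, finsetSum_coeff, mul_assoc]
  have h2 : ∀ s, ∑ j ∈ J, (X ^ j * p).coeff s = if s < m then 1 else 0 := by
    intro s
    rw [← coeff_geomSum, ← mul_eq_geomSum h, mul_comm p, expPoly_val, Finset.sum_mul,
      finsetSum_coeff]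
  have h3 : ∀ j s, 0 ≤ (X ^ j * p).coeff s := by
    intro j s
    rw [coeff_X_pow_mul']
    split_ifs
    · exact hp _
    · exact le_rfl
  have h4 : ∀ j, (X ^ j * p).coeff j = 1 := by
    intro j
    rw [coeff_X_pow_mul']
    simpa using hp0
  refine ⟨fun s hs => ?_, fun j hj => ⟨?_, ?_⟩⟩
  · have h5 := h2 s
    rw [if_neg (by omega), Finset.sum_eq_zero_iff_of_nonneg fun j _ => h3 j s] at h5
    rw [h1]
    exact Finset.sum_eq_zero fun j hj => by rw [h5 j hj, mul_zero]
  · by_contra hjm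
    have h5 := h2 j
    rw [if_neg hjm, Finset.sum_eq_zero_iff_of_nonneg fun i _ => h3 i j] at h5
    have := h5 j hj
    rw [h4] at this
    omega
  · have h5 := h2 j
    rw [← Finset.add_sum_erase _ _ hj, h4] at h5
    have h6 : ∑ i ∈ J.erase j, (X ^ i * p).coeff j = 0 := by
      have := Finset.sum_nonneg (s := J.erase j) fun i _ => h3 i j
      split_ifs at h5 <;> omega
    rw [Finset.sum_eq_zero_iff_of_nonneg fun i _ => h3 i j] at h6
    rw [h1, ← Finset.add_sum_erase _ _ hj, h4, Finset.sum_eq_zero fun i hi => by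
      rw [h6 i hi, mul_zero]]
    ring

/-- If `L (X - 1) J + ∑_{j ∈ J} d_j X ^ j` is nonnegative and `L` is nonnegative, then every `d_j` is
nonnegative: multiply by the complement of `J`. -/
theorem nonneg_of_krasner {m : ℕ} {p L : ℤ[X]} {J : Finset ℕ} (hp : NonnegCoeffs p)
    (hp0 : p.coeff 0 = 1) (h : p * (X - 1) * expPoly J.val + 1 = X ^ m) {d : ℕ → ℤ}
    (hL : NonnegCoeffs L)
    (hd : NonnegCoeffs (L * (X - 1) * expPoly J.val + ∑ j ∈ J, C (d j) * X ^ j)) :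
    ∀ j ∈ J, 0 ≤ d j := by
  intro j hj
  obtain ⟨hjm, hdj⟩ := (coeff_sum_mul_of_krasner hp hp0 h d).2 j hj
  have h1 : NonnegCoeffs ((X ^ m - 1) * L + (∑ j ∈ J, C (d j) * X ^ j) * p) := by
    have := hd.mul hp
    rw [← h]
    convert this using 1
    ring
  rw [← hdj]
  exact (hL j).trans (coeff_le_coeff h1 hjm)

/-- The composition principle for the two conditions `(L (X - 1) + 1) J ≥ 0` and
`I ((X - 1) M + 1) ≥ 0`: their product is `(X ^ m - 1) Y + (1 + ⋯ + X ^ (m - 1))` for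
`Y = L (X - 1) M + L + M`. -/
theorem nonneg_comp_of_krasner {m : ℕ} (hm : 0 < m) {p q L M : ℤ[X]}
    (h : p * (X - 1) * q + 1 = X ^ m) (hL : NonnegCoeffs (L * (X - 1) * q + q))
    (hM : NonnegCoeffs (p * (1 + (X - 1) * M))) : NonnegCoeffs (L * (X - 1) * M + L + M) := by
  refine nonnegCoeffs_of_column hm (E := ∑ i ∈ Finset.range m, X ^ i) ?_ fun s hs => by
    rw [coeff_geomSum, if_neg (by omega)]
  have h1 := hL.mul hM
  rw [← mul_eq_geomSum h, ← h]
  convert h1 using 1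
  ring

/-! ### Words and the number of occurrences of `b` -/

theorem aWord_zero : aWord 0 = 1 := rfl

theorem aWord_succ (t : ℕ) : aWord (t + 1) = aWord t * FreeMonoid.of Letter.a := pow_succ _ _

theorem length_aWord (t : ℕ) : (aWord t).length = t := by
  induction t with
  | zero => rfl
  | succ t ih => rw [aWord_succ, FreeMonoid.length_mul, ih]; rfl

theorem aWord_injective : Function.Injective aWord := fun s t h => by
  rw [← length_aWord s, h, length_aWord]

theorem bCount_mul (u v : Word) : bCount (u * v) = bCount u + bCount v := by
  simp [bCount]

theorem bCount_bWord : bCount bWord = 1 := rfl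

theorem bCount_one : bCount 1 = 0 := rfl

theorem bCount_aWord (t : ℕ) : bCount (aWord t) = 0 := by
  induction t with
  | zero => rfl
  | succ t ih => rw [aWord_succ, bCount_mul, ih]; rfl

theorem bCount_mul_b_a (z : Word) (t : ℕ) : bCount (z * bWord * aWord t) = bCount z + 1 := by
  rw [bCount_mul, bCount_mul, bCount_bWord, bCount_aWord]

/-- A word is a power of `a`, or has a last occurrence of `b`. -/
theorem eq_aWord_or_eq_mul_b_a (w : Word) :
    (∃ t, w = aWord t) ∨ ∃ z t, w = z * bWord * aWord t := by
  induction w using FreeMonoid.inductionOn' with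
  | one => exact Or.inl ⟨0, rfl⟩
  | of_mul x w ih =>
    rcases ih with ⟨t, rfl⟩ | ⟨z, t, rfl⟩
    · cases x
      · exact Or.inl ⟨t + 1, (pow_succ' _ _).symm⟩
      · exact Or.inr ⟨1, t, by rw [one_mul]; rfl⟩
    · exact Or.inr ⟨FreeMonoid.of x * z, t, by simp only [mul_assoc]⟩

/-- The word `u` does not end in `a`. -/
def NotEndsInA (u : Word) : Prop := ∀ v, v * FreeMonoid.of Letter.a ≠ u

theorem notEndsInA_one : NotEndsInA 1 := fun v h => by
  simpa using congrArg FreeMonoid.length h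

theorem mul_of_a_ne (v z : Word) : v * FreeMonoid.of Letter.a ≠ z * bWord := fun h => by
  have := congrArg (fun w : Word => (FreeMonoid.toList w).getLast?) h
  simp [bWord] at this

theorem notEndsInA_mul_b (z : Word) : NotEndsInA (z * bWord) := fun v => mul_of_a_ne v z

/-! ### Fibers of a polynomial over the last occurrence of `b` -/

theorem mul_aWord_injective (u : Word) : Function.Injective fun t => u * aWord t :=
  fun _ _ h => aWord_injective (mul_left_cancel h)

/-- The one-variable polynomial whose coefficient at `X ^ t` is the coefficient of `Y` at `u a ^ t`. It
is used for `u = 1` and for words `u` that end in `b`, which together account for each word once. -/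
noncomputable def fiber (u : Word) (Y : NCPoly) : ℤ[X] :=
  ⟨AddMonoidAlgebra.ofCoeff
    (Y.coeff.comapDomain (fun t => u * aWord t) (mul_aWord_injective u).injOn)⟩

theorem coeff_fiber (u : Word) (Y : NCPoly) (t : ℕ) :
    (fiber u Y).coeff t = Y.coeff (u * aWord t) := rfl

theorem fiber_zero (u : Word) : fiber u 0 = 0 := by
  ext t; simp [coeff_fiber]

theorem fiber_add (u : Word) (Y Z : NCPoly) : fiber u (Y + Z) = fiber u Y + fiber u Z := by
  ext t; simp [coeff_fiber]

theorem fiber_sub (u : Word) (Y Z : NCPoly) : fiber u (Y - Z) = fiber u Y - fiber u Z := by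
  ext t; simp [coeff_fiber]

theorem fiber_smul (u : Word) (c : ℤ) (Y : NCPoly) : fiber u (c • Y) = c • fiber u Y := by
  ext t
  rw [coeff_smul, coeff_fiber, coeff_fiber, MonoidAlgebra.coeff_smul_apply]

theorem fiber_sum {ι : Type*} (u : Word) (s : Finset ι) (f : ι → NCPoly) :
    fiber u (∑ i ∈ s, f i) = ∑ i ∈ s, fiber u (f i) := by
  classical
  induction s using Finset.induction_on with
  | empty => simp [fiber_zero]
  | insert i s hi ih => rw [Finset.sum_insert hi, Finset.sum_insert hi, fiber_add, ih]

theorem fiber_one_one : fiber 1 1 = 1 := by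
  ext t
  rw [coeff_fiber, coeff_one_apply, one_mul, coeff_one, ← aWord_zero]
  simp [aWord_injective.eq_iff]

theorem fiber_b_one (z : Word) : fiber (z * bWord) 1 = 0 := by
  ext t
  rw [coeff_fiber, coeff_one_apply, coeff_zero, if_neg]
  intro h
  have := congrArg bCount h
  rw [bCount_mul_b_a, bCount_one] at this
  omega

theorem va_eq : va = mono (FreeMonoid.of Letter.a) := by simp [va, aWord]

theorem fiber_mul_va {u : Word} (hu : NotEndsInA u) (Y : NCPoly) :
    fiber u (Y * va) = fiber u Y * X := by
  ext t
  rw [coeff_fiber]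
  cases t with
  | zero =>
    rw [coeff_mul_X_zero, va_eq, mono, aWord_zero, mul_one,
      MonoidAlgebra.coeff_mul_single_of_forall_mul_ne _ _ hu]
  | succ t => rw [coeff_mul_X, coeff_fiber, va_eq, aWord_succ, ← mul_assoc, coeff_mul_mono]

theorem fiber_mul_aeval {u : Word} (hu : NotEndsInA u) (Y : NCPoly) (q : ℤ[X]) :
    fiber u (Y * aeval va q) = fiber u Y * q := by
  induction q using Polynomial.induction_on' with
  | add p q hp hq => rw [map_add, mul_add, fiber_add, hp, hq, mul_add]
  | monomial t c =>
    have h : ∀ t, fiber u (Y * va ^ t) = fiber u Y * X ^ t := by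
      intro t
      induction t with
      | zero => simp
      | succ t ih => rw [pow_succ, ← mul_assoc, fiber_mul_va hu, ih, pow_succ, mul_assoc]
    rw [aeval_monomial, ← Algebra.smul_def, mul_smul_comm, fiber_smul, h, ← C_mul_X_pow_eq_monomial,
      C_mul', mul_smul_comm]

theorem fiber_one_aeval (q : ℤ[X]) : fiber 1 (aeval va q) = q := by
  rw [← one_mul (aeval va q), fiber_mul_aeval notEndsInA_one, fiber_one_one, one_mul]

theorem fiber_b_aeval (z : Word) (q : ℤ[X]) : fiber (z * bWord) (aeval va q) = 0 := by
  rw [← one_mul (aeval va q), fiber_mul_aeval (notEndsInA_mul_b z), fiber_b_one, zero_mul]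

theorem fiber_one_mul_vb (Y : NCPoly) : fiber 1 (Y * vb) = 0 := by
  ext t
  rw [coeff_fiber, coeff_zero, vb, mono, MonoidAlgebra.coeff_mul_single_of_forall_mul_ne]
  intro d h
  have := congrArg bCount h
  rw [bCount_mul, bCount_mul, bCount_bWord, bCount_aWord, bCount_one] at this
  omega

theorem fiber_b_mul_vb (z : Word) (Y : NCPoly) : fiber (z * bWord) (Y * vb) = C (Y.coeff z) := by
  ext t
  rw [coeff_fiber, coeff_C]
  cases t with
  | zero => rw [aWord_zero, mul_one, vb, coeff_mul_mono, if_pos rfl]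
  | succ t =>
    rw [if_neg (by omega), vb, mono, MonoidAlgebra.coeff_mul_single_of_forall_mul_ne]
    intro d h
    rw [aWord_succ, ← mul_assoc] at h
    exact mul_of_a_ne _ _ h.symm

theorem coeffGE_zero_iff_fiber {Y : NCPoly} :
    CoeffGE Y 0 ↔ NonnegCoeffs (fiber 1 Y) ∧ ∀ z, NonnegCoeffs (fiber (z * bWord) Y) := by
  refine ⟨fun h => ⟨fun t => h _, fun z t => h _⟩, fun h w => ?_⟩
  rcases eq_aWord_or_eq_mul_b_a w with ⟨t, rfl⟩ | ⟨z, t, rfl⟩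
  · simpa [coeff_fiber] using h.1 t
  · exact h.2 z t

theorem coeffGE_aeval {q : ℤ[X]} : CoeffGE (aeval va q) 0 ↔ NonnegCoeffs q := by
  rw [coeffGE_zero_iff_fiber, fiber_one_aeval]
  refine ⟨And.left, fun h => ⟨h, fun z => ?_⟩⟩
  rw [fiber_b_aeval]
  exact nonnegCoeffs_zero

theorem mono_aWord (t : ℕ) : mono (aWord t) = va ^ t := by
  induction t with
  | zero => rfl
  | succ t ih => rw [aWord_succ, ← mono_mul_mono, ih, pow_succ, va_eq]

theorem aPoly_eq (H : Multiset ℕ) : aPoly H = aeval va (expPoly H) := by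
  rw [aPoly, expPoly, map_multiset_sum, Multiset.map_map]
  congr 1
  refine Multiset.map_congr rfl fun t _ => ?_
  simp [mono_aWord]

theorem aPoly_nonneg (H : Multiset ℕ) : CoeffGE (aPoly H) 0 := by
  rw [aPoly_eq, coeffGE_aeval]
  exact expPoly_nonneg H

theorem krasnerS_nonneg (J : Finset ℕ) (M : ℕ → Multiset ℕ) : CoeffGE (krasnerS J M) 0 := by
  refine (aPoly_nonneg _).add_nonneg ?_
  refine Finset.sum_induction _ (fun Y => CoeffGE Y 0) (fun _ _ => CoeffGE.add_nonneg)
    (fun _ => le_rfl) fun j _ => ?_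
  exact ((aPoly_nonneg _).mul_nonneg (mono_nonneg _)).mul_nonneg (mono_nonneg _)

/-! ### The fibers of `P (A - 1) S + 1` -/

/-- The polynomial `D = Y + Y (A - 1) a ^ M`. For `S = a ^ J + ∑_{j ∈ J} a ^ {M_j} b a ^ j` one has
`P (A - 1) S = P (a - 1) a ^ J + ∑_{j ∈ J} D_j b a ^ j`, with `D_j` built from `P` and `M_j`. -/
noncomputable def bracket (M : Multiset ℕ) (Y : NCPoly) : NCPoly :=
  Y + Y * (va + vb - 1) * aPoly M

/-- The polynomial `P (A - 1) S + 1` for `S = a ^ J + ∑_{j ∈ J} a ^ {M_j} b a ^ j`. -/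
noncomputable def codePoly (J : Finset ℕ) (M : ℕ → Multiset ℕ) (P : NCPoly) : NCPoly :=
  P * (va + vb - 1) * krasnerS J M + 1

theorem codePoly_eq (P : NCPoly) (J : Finset ℕ) (M : ℕ → Multiset ℕ) :
    codePoly J M P =
      P * aeval va ((X - 1) * expPoly J.val) +
        ∑ j ∈ J, bracket (M j) P * vb * aeval va (X ^ j : ℤ[X]) + 1 := by
  have h1 : P * vb * aPoly J.val = ∑ j ∈ J, P * vb * aeval va (X ^ j : ℤ[X]) := by
    rw [aPoly_eq, expPoly_val, map_sum, Finset.mul_sum]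
  have h2 : ∑ j ∈ J, bracket (M j) P * vb * aeval va (X ^ j : ℤ[X]) =
      P * vb * aPoly J.val +
        P * (va + vb - 1) * ∑ j ∈ J, aPoly (M j) * vb * mono (aWord j) := by
    rw [h1, Finset.mul_sum, ← Finset.sum_add_distrib]
    refine Finset.sum_congr rfl fun j _ => ?_
    rw [bracket, mono_aWord, map_pow, aeval_X]
    noncomm_ring
  rw [codePoly, h2, krasnerS, map_mul, map_sub, aeval_X, map_one, ← aPoly_eq]
  noncomm_ring

theorem fiber_one_codePoly (P : NCPoly) (J : Finset ℕ) (M : ℕ → Multiset ℕ) :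
    fiber 1 (codePoly J M P) =
      fiber 1 P * (X - 1) * expPoly J.val + 1 := by
  rw [codePoly_eq, fiber_add, fiber_add, fiber_mul_aeval notEndsInA_one, fiber_one_one, fiber_sum,
    Finset.sum_eq_zero, add_zero, mul_assoc]
  intro j _
  rw [fiber_mul_aeval notEndsInA_one, fiber_one_mul_vb, zero_mul]

theorem fiber_b_codePoly (P : NCPoly) (J : Finset ℕ) (M : ℕ → Multiset ℕ) (w : Word) :
    fiber (w * bWord) (codePoly J M P) =
      fiber (w * bWord) P * (X - 1) * expPoly J.val +
        ∑ j ∈ J, C ((bracket (M j) P).coeff w) * X ^ j := by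
  rw [codePoly_eq, fiber_add, fiber_add, fiber_mul_aeval (notEndsInA_mul_b w), fiber_b_one,
    fiber_sum, add_zero, mul_assoc]
  congr 1
  refine Finset.sum_congr rfl fun j _ => ?_
  rw [fiber_mul_aeval (notEndsInA_mul_b w), fiber_b_mul_vb]

theorem fiber_one_bracket (M : Multiset ℕ) (Y : NCPoly) :
    fiber 1 (bracket M Y) = fiber 1 Y * (1 + (X - 1) * expPoly M) := by
  rw [bracket, fiber_add, aPoly_eq, fiber_mul_aeval notEndsInA_one,
    show Y * (va + vb - 1) = Y * va + Y * vb - Y by noncomm_ring, fiber_sub, fiber_add,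
    fiber_mul_va notEndsInA_one, fiber_one_mul_vb]
  ring

theorem fiber_b_bracket (M : Multiset ℕ) (Y : NCPoly) (z : Word) :
    fiber (z * bWord) (bracket M Y) =
      fiber (z * bWord) Y * (1 + (X - 1) * expPoly M) + C (Y.coeff z) * expPoly M := by
  rw [bracket, fiber_add, aPoly_eq, fiber_mul_aeval (notEndsInA_mul_b z),
    show Y * (va + vb - 1) = Y * va + Y * vb - Y by noncomm_ring, fiber_sub, fiber_add,
    fiber_mul_va (notEndsInA_mul_b z), fiber_b_mul_vb]
  ring

/-- The coefficient at `w` of the bracket depends only on the words with at most as many occurrences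
of `b` as `w`. -/
theorem bracket_congr {M : Multiset ℕ} {Y Z : NCPoly} {w : Word}
    (h : ∀ v, bCount v ≤ bCount w → Y.coeff v = Z.coeff v) :
    (bracket M Y).coeff w = (bracket M Z).coeff w := by
  rcases eq_aWord_or_eq_mul_b_a w with ⟨t, rfl⟩ | ⟨z, t, rfl⟩
  · have h1 : fiber 1 Y = fiber 1 Z := by
      ext s
      exact h _ (by rw [bCount_mul, bCount_one, bCount_aWord]; omega)
    have h2 := fiber_one_bracket M Y
    rw [h1, ← fiber_one_bracket] at h2
    simpa [coeff_fiber] using congrArg (fun p => p.coeff t) h2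
  · have h1 : fiber (z * bWord) Y = fiber (z * bWord) Z := by
      ext s
      exact h _ (by rw [bCount_mul_b_a, bCount_mul_b_a])
    have h2 := fiber_b_bracket M Y z
    rw [h1, h z (by rw [bCount_mul_b_a]; omega), ← fiber_b_bracket] at h2
    exact congrArg (fun p => p.coeff t) h2

theorem coeff_codePoly_b (P : NCPoly) (J : Finset ℕ) (M : ℕ → Multiset ℕ) {w : Word}
    (hw : fiber (w * bWord) P = 0) (t : ℕ) :
    (codePoly J M P).coeff (w * bWord * aWord t) =
      if t ∈ J then (bracket (M t) P).coeff w else 0 := by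
  rw [← coeff_fiber, fiber_b_codePoly, hw, zero_mul, zero_mul, zero_add, finsetSum_coeff]
  simp [coeff_X_pow]

theorem coeff_bracket_b {P : NCPoly} {M : Multiset ℕ} {z : Word} (hz : fiber (z * bWord) P = 0)
    (s : ℕ) : (bracket M P).coeff (z * bWord * aWord s) = P.coeff z * M.count s := by
  rw [← coeff_fiber, fiber_b_bracket, hz, zero_mul, zero_add, coeff_C_mul, coeff_expPoly]

theorem fiber_b_eq_zero {P : NCPoly} {z : Word}
    (h : ∀ v, bCount v = bCount z + 1 → P.coeff v = 0) : fiber (z * bWord) P = 0 := by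
  ext t
  exact h _ (bCount_mul_b_a z t)

theorem codePoly_nonneg_iff {P : NCPoly} {J : Finset ℕ} {M : ℕ → Multiset ℕ} :
    CoeffGE (codePoly J M P) 0 ↔
      NonnegCoeffs (fiber 1 P * (X - 1) * expPoly J.val + 1) ∧
        ∀ z, NonnegCoeffs (fiber (z * bWord) P * (X - 1) * expPoly J.val +
          ∑ j ∈ J, C ((bracket (M j) P).coeff z) * X ^ j) := by
  simp only [coeffGE_zero_iff_fiber, fiber_one_codePoly, fiber_b_codePoly]

theorem nonnegCoeffs_sum_C_mul {J : Finset ℕ} {d : ℕ → ℤ} (h : ∀ j ∈ J, 0 ≤ d j) :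
    NonnegCoeffs (∑ j ∈ J, C (d j) * X ^ j) := fun s => by
  rw [finsetSum_coeff]
  refine Finset.sum_nonneg fun j hj => ?_
  rw [coeff_C_mul, coeff_X_pow]
  split_ifs
  · simpa using h j hj
  · simp

/-! ### Consequences of nonnegativity -/

/-- If `P (A - 1) S + 1` is nonnegative without constant term, then its part without `b` is a power of
`a`, so that `P_0` and `J` form a Krasner factorization. -/
theorem exists_krasner {P : NCPoly} {J : Finset ℕ} {M : ℕ → Multiset ℕ}
    (hP : CoeffGE P 0) (h0 : CoeffGE (codePoly J M P) 0) (h1 : (codePoly J M P).coeff 1 = 0) :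
    NonnegCoeffs (fiber 1 P) ∧ (fiber 1 P).coeff 0 = 1 ∧
      ∃ m, 0 < m ∧ fiber 1 P * (X - 1) * expPoly J.val + 1 = X ^ m := by
  refine ⟨(coeffGE_zero_iff_fiber.1 hP).1, ?_, ?_⟩
  · rw [coeff_fiber, aWord_zero, mul_one]
    exact (constCoeff_eq_one rfl hP (krasnerS_nonneg J M) h1).1
  · obtain ⟨m, hm⟩ := (codePoly_nonneg_iff.1 h0).1.eq_X_pow (by simp)
    refine ⟨m, Nat.pos_of_ne_zero ?_, hm⟩
    rintro rfl
    have h2 : (fiber 1 (codePoly J M P)).coeff 0 = 0 := by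
      rw [coeff_fiber, aWord_zero, mul_one, h1]
    rw [fiber_one_codePoly, hm] at h2
    simp at h2

/-- The part of `P (A - 1) S + 1` contributed by the words `w b a ^ j` through the bracket of `P` is
nonnegative by itself. -/
theorem bracket_nonneg {P : NCPoly} {J : Finset ℕ} {M : ℕ → Multiset ℕ}
    (hP : CoeffGE P 0) (h0 : CoeffGE (codePoly J M P) 0) (h1 : (codePoly J M P).coeff 1 = 0)
    (w : Word) : ∀ j ∈ J, 0 ≤ (bracket (M j) P).coeff w := by
  obtain ⟨hp, hp0, m, -, hm⟩ := exists_krasner hP h0 h1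
  exact nonneg_of_krasner hp hp0 hm ((coeffGE_zero_iff_fiber.1 hP).2 w)
    ((codePoly_nonneg_iff.1 h0).2 w)

/-- A word `w b a ^ t` of `P` comes with a nonzero coefficient `(D_j, w)`, since otherwise
`p (X - 1) J ≥ 0` for the fiber `p` of `P` at `w`, and this polynomial vanishes at `X = 1`. -/
theorem exists_bracket_ne_zero {P : NCPoly} {J : Finset ℕ} {M : ℕ → Multiset ℕ}
    (hP : CoeffGE P 0) (h0 : CoeffGE (codePoly J M P) 0) (h1 : (codePoly J M P).coeff 1 = 0)
    {w : Word} (hw : fiber (w * bWord) P ≠ 0) : ∃ j ∈ J, (bracket (M j) P).coeff w ≠ 0 := by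
  obtain ⟨-, -, m, hm0, hm⟩ := exists_krasner hP h0 h1
  by_contra! hcon
  have h2 := (codePoly_nonneg_iff.1 h0).2 w
  rw [Finset.sum_eq_zero (fun j hj => by rw [hcon j hj, C_0, zero_mul]), add_zero] at h2
  have h3 := h2.eq_zero_of_eval_one (by simp)
  have hX : (X - 1 : ℤ[X]) ≠ 0 := X_sub_C_ne_zero (1 : ℤ)
  rcases mul_eq_zero.1 h3 with h3 | h3
  · exact (mul_ne_zero hw hX) h3
  · rw [h3, mul_zero, zero_add] at hm
    have := congrArg (fun p : ℤ[X] => p.coeff 0) hm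
    simp [coeff_X_pow, hm0.ne] at this

/-! ### The number of occurrences of `b` in `P (A - 1) S + 1` -/

theorem coeff_codePoly_eq_zero {P : NCPoly} {J : Finset ℕ} {M : ℕ → Multiset ℕ} {d : ℕ}
    (h : ∀ v, d ≤ bCount v → P.coeff v = 0) {w : Word} (hw : d + 2 ≤ bCount w) :
    (codePoly J M P).coeff w = 0 := by
  rcases eq_aWord_or_eq_mul_b_a w with ⟨t, rfl⟩ | ⟨y, t, rfl⟩
  · rw [bCount_aWord] at hw; omega
  rw [bCount_mul_b_a] at hw
  rw [coeff_codePoly_b _ _ _ (fiber_b_eq_zero fun v hv => h v (by omega))]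
  split_ifs
  · rcases eq_aWord_or_eq_mul_b_a y with ⟨s, rfl⟩ | ⟨z, s, rfl⟩
    · rw [bCount_aWord] at hw; omega
    rw [bCount_mul_b_a] at hw
    rw [coeff_bracket_b (fiber_b_eq_zero fun v hv => h v (by omega)), h z (by omega), zero_mul]
  · rfl

/-- If every `M_j` were empty, then `S = a ^ J`, and the words of `P (A - 1) S + 1` would have at most one
occurrence of `b` more than those of `P`. -/
theorem exists_exponents_ne_zero {P : NCPoly} {J : Finset ℕ} {M : ℕ → Multiset ℕ} {d : ℕ}
    (h : ∀ v, d ≤ bCount v → P.coeff v = 0) {w : Word} (hw : d + 1 ≤ bCount w)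
    (hne : (codePoly J M P).coeff w ≠ 0) : ∃ j ∈ J, M j ≠ 0 := by
  by_contra! hcon
  refine hne ?_
  rcases eq_aWord_or_eq_mul_b_a w with ⟨t, rfl⟩ | ⟨y, t, rfl⟩
  · rw [bCount_aWord] at hw; omega
  rw [bCount_mul_b_a] at hw
  rw [coeff_codePoly_b _ _ _ (fiber_b_eq_zero fun v hv => h v (by omega))]
  split_ifs with ht
  · rw [hcon t ht, bracket]
    simp [aPoly, h y (by omega)]
  · rfl

theorem exists_coeff_codePoly_ne_zero {P : NCPoly} {J : Finset ℕ} {M : ℕ → Multiset ℕ} {z : Word}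
    (h : ∀ v, bCount z < bCount v → P.coeff v = 0) (hz : P.coeff z ≠ 0) (hM : ∃ j ∈ J, M j ≠ 0) :
    ∃ w, bCount w = bCount z + 2 ∧ (codePoly J M P).coeff w ≠ 0 := by
  obtain ⟨j, hj, hMj⟩ := hM
  obtain ⟨s, hs⟩ := Multiset.exists_mem_of_ne_zero hMj
  refine ⟨z * bWord * aWord s * bWord * aWord j, by rw [bCount_mul_b_a, bCount_mul_b_a], ?_⟩
  rw [coeff_codePoly_b _ _ _ (fiber_b_eq_zero fun v hv => h v (by rw [bCount_mul_b_a] at hv; omega)),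
    if_pos hj, coeff_bracket_b (fiber_b_eq_zero fun v hv => h v (by omega))]
  have := Multiset.count_pos.2 hs
  exact mul_ne_zero hz (by omega)

theorem mem_iff_coeff_charPoly {X : Finset Word} {w : Word} :
    w ∈ X ↔ (charPoly X).coeff w ≠ 0 := by
  rw [coeff_charPoly]; split_ifs <;> simp_all

theorem IsMCode.of_coeff {m : ℕ} {X : Finset Word} {Y : NCPoly} (hX : charPoly X = Y)
    (hmax : IsFiniteMaximalCode X) (hle : ∀ w, m + 1 ≤ bCount w → Y.coeff w = 0)
    (hex : ∃ w, bCount w = m ∧ Y.coeff w ≠ 0) : IsMCode m X := by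
  refine ⟨hmax, fun w hw => ?_, ?_⟩
  · by_contra hlt
    exact mem_iff_coeff_charPoly.1 hw (by rw [hX]; exact hle w (by omega))
  · obtain ⟨w, hw, hne⟩ := hex
    exact ⟨w, mem_iff_coeff_charPoly.2 (by rwa [hX]), hw⟩

theorem IsMCode.coeff_one {m : ℕ} {X : Finset Word} (h : IsMCode m X) :
    (charPoly X).coeff 1 = 0 := by
  have h1 : (1 : Word) ∉ X := h.1.prop.one_notMem
  rw [coeff_charPoly, if_neg h1]

/-! ### Truncation of `P` -/

theorem coeff_bPart (g : ℕ) (P : NCPoly) (w : Word) :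
    (bPart g P).coeff w = if bCount w = g then P.coeff w else 0 := by
  rw [bPart, MonoidAlgebra.coeff_ofCoeff, Finsupp.filter_apply]

/-- `P'` is the part of `P` with at most `k` occurrences of `b`, and `P` has no words with more than
`k + 1` of them. -/
structure IsTruncation (k : ℕ) (P P' : NCPoly) : Prop where
  coeff_le : ∀ w, bCount w ≤ k → P'.coeff w = P.coeff w
  coeff_gt : ∀ w, k < bCount w → P'.coeff w = 0
  coeff_top : ∀ w, k + 1 < bCount w → P.coeff w = 0

theorem isTruncation_of_bPart {k : ℕ} {P P' : NCPoly}
    (hP' : P' = ∑ g ∈ Finset.range (k + 1), bPart g P) (hP : P = P' + bPart (k + 1) P) :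
    IsTruncation k P P' := by
  have h : ∀ w, P'.coeff w = if bCount w ≤ k then P.coeff w else 0 := by
    intro w
    rw [hP', MonoidAlgebra.coeff_sum, Finsupp.finsetSum_apply]
    simp [coeff_bPart]
  refine ⟨fun w hw => by rw [h, if_pos hw], fun w hw => by rw [h, if_neg (by omega)],
    fun w hw => ?_⟩
  rw [hP, MonoidAlgebra.coeff_add, Finsupp.add_apply, h, coeff_bPart, if_neg (by omega),
    if_neg (by omega), add_zero]

section Truncation

variable {k : ℕ} {P P' : NCPoly} {J : Finset ℕ} {M : ℕ → Multiset ℕ}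

theorem IsTruncation.nonneg (h : IsTruncation k P P') (hP : CoeffGE P 0) : CoeffGE P' 0 :=
  fun w => by
    rcases le_or_gt (bCount w) k with hw | hw
    · rw [h.coeff_le w hw]; exact hP w
    · rw [h.coeff_gt w hw]; exact le_rfl

theorem IsTruncation.fiber_one (h : IsTruncation k P P') : fiber 1 P' = fiber 1 P := by
  ext t
  exact h.coeff_le _ (by rw [bCount_mul, bCount_aWord, bCount_one]; omega)

theorem IsTruncation.fiber_b (h : IsTruncation k P P') {z : Word} (hz : bCount z < k) :
    fiber (z * bWord) P' = fiber (z * bWord) P := by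
  ext t
  exact h.coeff_le _ (by rw [bCount_mul_b_a]; omega)

theorem IsTruncation.fiber_b_eq_zero (h : IsTruncation k P P') {z : Word} (hz : k ≤ bCount z) :
    fiber (z * bWord) P' = 0 :=
  FactorizingCodes.fiber_b_eq_zero fun v hv => h.coeff_gt v (by omega)

theorem IsTruncation.fiber_b_eq_zero_top (h : IsTruncation k P P') {z : Word} (hz : k < bCount z) :
    fiber (z * bWord) P = 0 :=
  FactorizingCodes.fiber_b_eq_zero fun v hv => h.coeff_top v (by omega)

theorem IsTruncation.bracket_eq (h : IsTruncation k P P') {z : Word} (hz : bCount z ≤ k)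
    (N : Multiset ℕ) : (bracket N P').coeff z = (bracket N P).coeff z :=
  bracket_congr fun v hv => h.coeff_le v (by omega)

theorem IsTruncation.coeff_one (h : IsTruncation k P P') :
    (codePoly J M P').coeff 1 = (codePoly J M P).coeff 1 := by
  have h1 := fiber_one_codePoly P' J M
  rw [h.fiber_one, ← fiber_one_codePoly P J M] at h1
  simpa [coeff_fiber, aWord_zero] using congrArg (fun p => p.coeff 0) h1

theorem IsTruncation.codePoly_nonneg (h : IsTruncation k P P') (hP : CoeffGE P 0)
    (h0 : CoeffGE (codePoly J M P) 0) (h1 : (codePoly J M P).coeff 1 = 0) :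
    CoeffGE (codePoly J M P') 0 := by
  have h2 := codePoly_nonneg_iff.1 h0
  refine codePoly_nonneg_iff.2 ⟨by rw [h.fiber_one]; exact h2.1, fun z => ?_⟩
  rcases lt_or_ge (bCount z) k with hz | hz
  · simp only [h.bracket_eq hz.le, h.fiber_b hz]
    exact h2.2 z
  rw [h.fiber_b_eq_zero hz, zero_mul, zero_mul, zero_add]
  refine nonnegCoeffs_sum_C_mul fun j hj => ?_
  rcases hz.eq_or_lt with hz | hz
  · rw [h.bracket_eq hz.ge]
    exact bracket_nonneg hP h0 h1 z j hj
  rcases eq_aWord_or_eq_mul_b_a z with ⟨s, rfl⟩ | ⟨y, s, rfl⟩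
  · rw [bCount_aWord] at hz; omega
  rw [bCount_mul_b_a] at hz
  rw [coeff_bracket_b (h.fiber_b_eq_zero (by omega))]
  have : 0 ≤ P'.coeff y := h.nonneg hP y
  positivity

/-! ### The words `z b a ^ j` of the code of `P'` -/

theorem mem_contexts {X : Finset Word} {z : Word} :
    z ∈ contexts J (wordsWith X (k + 1)) ↔
      bCount z = k ∧ ∃ j ∈ J, z * bWord * aWord j ∈ X := by
  simp only [contexts, contextSet, Set.Finite.mem_toFinset, Set.mem_ofPred_eq, wordsWith,
    Finset.mem_filter, bCount_mul_b_a]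
  constructor
  · rintro ⟨j, hj, h1, h2⟩
    exact ⟨by omega, j, hj, h1⟩
  · rintro ⟨h1, j, hj, h2⟩
    exact ⟨j, hj, h2, by omega⟩

theorem IsTruncation.mem_iff (h : IsTruncation k P P') {X : Finset Word}
    (hX : charPoly X = codePoly J M P') {z : Word} (hz : bCount z = k) (t : ℕ) :
    z * bWord * aWord t ∈ X ↔ t ∈ J ∧ (bracket (M t) P).coeff z ≠ 0 := by
  rw [mem_iff_coeff_charPoly, hX, coeff_codePoly_b _ _ _ (h.fiber_b_eq_zero hz.ge),
    h.bracket_eq hz.le]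
  split_ifs with ht <;> simp [ht]

/-- The exponents `J_z` are read off from the brackets of `P`, which agree at `z` with those of `P'`. -/
theorem IsTruncation.sum_bracket (h : IsTruncation k P P') {X : Finset Word}
    (hX : charPoly X = codePoly J M P') {z : Word} (hz : bCount z = k) :
    ∑ j ∈ J, C ((bracket (M j) P).coeff z) * Polynomial.X ^ j =
      expPoly (rightExps J (wordsWith X (k + 1)) z).val := by
  have h1 := fiber_b_codePoly P' J M z
  rw [← hX, h.fiber_b_eq_zero hz.ge, zero_mul, zero_mul, zero_add] at h1
  simp only [h.bracket_eq hz.le] at h1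
  rw [← h1]
  ext t
  rw [coeff_fiber, coeff_charPoly, coeff_expPoly_val]
  refine if_congr ?_ rfl rfl
  simp only [rightExps, wordsWith, Finset.mem_filter, bCount_mul_b_a, hz, and_true]
  exact ⟨fun h2 => ⟨((h.mem_iff hX hz t).1 h2).1, h2⟩, And.right⟩

theorem coeffGE_aPoly_iff {L N K : Multiset ℕ} :
    CoeffGE (aPoly L * (va - 1) * aPoly N + aPoly K) 0 ↔
      NonnegCoeffs (expPoly L * (X - 1) * expPoly N + expPoly K) := by
  rw [← coeffGE_aeval]
  simp [aPoly_eq]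

theorem coeffGE_add_aPoly_of_subset {H K : Finset ℕ} (h : H ⊆ K) (Y : NCPoly) :
    CoeffGE (Y + aPoly K.val) (Y + aPoly H.val) := by
  rw [coeffGE_iff_sub, add_sub_add_left_eq_sub, aPoly_eq, aPoly_eq, ← map_sub, coeffGE_aeval]
  intro s
  rw [coeff_sub, coeff_expPoly_val, coeff_expPoly_val]
  by_cases hs : s ∈ H
  · simp [hs, h hs]
  · split_ifs <;> simp

theorem fiber_b_sum_contexts (Q : Finset Word) (L : Word → Finset ℕ) (z : Word) :
    fiber (z * bWord) (∑ y ∈ Q, mono y * vb * aPoly (L y).val) =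
      if z ∈ Q then expPoly (L z).val else 0 := by
  rw [fiber_sum]
  simp [aPoly_eq, fiber_mul_aeval (notEndsInA_mul_b z), fiber_b_mul_vb, coeff_mono]

theorem fiber_one_sum_contexts (Q : Finset Word) (L : Word → Finset ℕ) :
    fiber 1 (∑ y ∈ Q, mono y * vb * aPoly (L y).val) = 0 := by
  rw [fiber_sum]
  simp [aPoly_eq, fiber_mul_aeval notEndsInA_one, fiber_one_mul_vb]

theorem eq_of_fiber_eq {Y Z : NCPoly} (h1 : fiber 1 Y = fiber 1 Z)
    (h2 : ∀ z, fiber (z * bWord) Y = fiber (z * bWord) Z) : Y = Z := by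
  ext w
  rcases eq_aWord_or_eq_mul_b_a w with ⟨t, rfl⟩ | ⟨z, t, rfl⟩
  · simpa [coeff_fiber] using congrArg (fun p => p.coeff t) h1
  · exact congrArg (fun p => p.coeff t) (h2 z)

theorem fiber_one_bPart_succ (g : ℕ) (P : NCPoly) : fiber 1 (bPart (g + 1) P) = 0 := by
  ext t
  rw [coeff_fiber, coeff_bPart, bCount_mul, bCount_aWord, bCount_one, if_neg (by omega), coeff_zero]

theorem fiber_b_bPart_succ (g : ℕ) (P : NCPoly) (z : Word) :
    fiber (z * bWord) (bPart (g + 1) P) = if bCount z = g then fiber (z * bWord) P else 0 := by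
  ext t
  rw [coeff_fiber, coeff_bPart, bCount_mul_b_a]
  by_cases h : bCount z = g
  · rw [if_pos (by omega), if_pos h, coeff_fiber]
  · rw [if_neg (by omega), if_neg h, coeff_zero]

theorem exists_coeff_ne_zero_of_bPart {g : ℕ} (h : bPart g P ≠ 0) :
    ∃ z, bCount z = g ∧ P.coeff z ≠ 0 := by
  by_contra! hcon
  refine h ?_
  ext w
  rw [coeff_bPart]
  split_ifs with hw
  · rw [hcon w hw]; rfl
  · rfl

theorem IsTruncation.coeff_eq_zero_of_bPart (h : IsTruncation k P P') (hk : bPart k P = 0)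
    {w : Word} (hw : k ≤ bCount w) : P'.coeff w = 0 := by
  rcases hw.eq_or_lt with hw | hw
  · have h1 := coeff_bPart k P w
    rw [hk, if_pos hw.symm] at h1
    rw [h.coeff_le w hw.ge, ← h1]
    rfl
  · exact h.coeff_gt w hw

theorem IsTruncation.coeff_eq_zero (h : IsTruncation k P P') {w : Word}
    (hw : k + tIndex (bPart k P) ≤ bCount w + 1) : P'.coeff w = 0 := by
  by_cases hk : bPart k P = 0
  · rw [tIndex, if_neg (by simpa using hk)] at hw
    exact h.coeff_eq_zero_of_bPart hk (by omega)
  · rw [tIndex, if_pos hk] at hw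
    exact h.coeff_gt w (by omega)

theorem one_le_tIndex (R : NCPoly) : 1 ≤ tIndex R := by
  rw [tIndex]; split_ifs <;> omega

/-! ### From the code of `P` to the code of `P'` -/

theorem IsTruncation.exists_code (h : IsTruncation k P P') (hP : CoeffGE P 0)
    (htop : bPart (k + 1) P ≠ 0) {X : Finset Word} (hX : IsMCode (k + 3) X)
    (hXP : charPoly X = codePoly J M P) :
    ∃ X' : Finset Word, charPoly X' = codePoly J M P' ∧ IsMCode (k + tIndex (bPart k P)) X' ∧
      IsPositiveFactorization P' (krasnerS J M) X' := by
  have h0 : CoeffGE (codePoly J M P) 0 := hXP ▸ charPoly_nonneg X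
  have h1 : (codePoly J M P).coeff 1 = 0 := hXP ▸ hX.coeff_one
  obtain ⟨X', hX', hmax, hpos⟩ := exists_positiveFactorization (C := codePoly J M P') rfl
    (h.nonneg hP) (krasnerS_nonneg J M) (h.codePoly_nonneg hP h0 h1) (h.coeff_one.trans h1)
  refine ⟨X', hX', IsMCode.of_coeff hX' hmax (fun w hw => ?_) ?_, hpos⟩
  · obtain ⟨d, hd⟩ : ∃ d, k + tIndex (bPart k P) = d + 1 :=
      ⟨k + tIndex (bPart k P) - 1, by have := one_le_tIndex (bPart k P); omega⟩
    exact coeff_codePoly_eq_zero (d := d) (fun v hv => h.coeff_eq_zero (by omega)) (by omega)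
  by_cases hk : bPart k P = 0
  · rw [tIndex, if_neg (by simpa using hk)]
    obtain ⟨w, hw, hne⟩ := exists_coeff_ne_zero_of_bPart htop
    rcases eq_aWord_or_eq_mul_b_a w with ⟨t, rfl⟩ | ⟨z, t, rfl⟩
    · rw [bCount_aWord] at hw; omega
    rw [bCount_mul_b_a] at hw
    have hz : bCount z = k := by omega
    obtain ⟨j, hj, hjne⟩ := exists_bracket_ne_zero hP h0 h1 (w := z) fun hf =>
      hne (by rw [← coeff_fiber, hf, coeff_zero])
    refine ⟨z * bWord * aWord j, by rw [bCount_mul_b_a, hz], ?_⟩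
    rw [← hX', ← mem_iff_coeff_charPoly, h.mem_iff hX' hz]
    exact ⟨hj, hjne⟩
  · rw [tIndex, if_pos hk]
    obtain ⟨z, hz, hne⟩ := exists_coeff_ne_zero_of_bPart hk
    obtain ⟨w, hwX, hw⟩ := hX.2.2
    have hM : ∃ j ∈ J, M j ≠ 0 := exists_exponents_ne_zero (d := k + 2) (w := w)
      (fun v hv => h.coeff_top v (by omega)) (by omega)
      (by rw [← hXP]; exact mem_iff_coeff_charPoly.1 hwX)
    obtain ⟨u, hu, hune⟩ := exists_coeff_codePoly_ne_zero (z := z)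
      (fun v hv => h.coeff_gt v (by omega)) (by rwa [h.coeff_le z hz.le]) hM
    exact ⟨u, by rw [hu, hz], hune⟩

/-- The sets `L_z` are the supports of the fibers of `P` at the words `z` with `k` occurrences of `b`. -/
theorem IsTruncation.exists_exponents (h : IsTruncation k P P') (hP : CoeffGE P 0)
    (hP01 : HasCoeffs01 P) (h0 : CoeffGE (codePoly J M P) 0) (h1 : (codePoly J M P).coeff 1 = 0)
    {X' : Finset Word} (hX' : charPoly X' = codePoly J M P') :
    ∃ L : Word → Finset ℕ,
      bPart (k + 1) P =
        ∑ z ∈ contexts J (wordsWith X' (k + 1)), mono z * vb * aPoly (L z).val ∧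
      (∀ z ∈ contexts J (wordsWith X' (k + 1)),
        CoeffGE
          (aPoly (L z).val * (va - 1) * aPoly J.val + aPoly J.val)
          (aPoly (L z).val * (va - 1) * aPoly J.val +
            aPoly (rightExps J (wordsWith X' (k + 1)) z).val) ∧
        CoeffGE
          (aPoly (L z).val * (va - 1) * aPoly J.val +
            aPoly (rightExps J (wordsWith X' (k + 1)) z).val)
          0) ∧
      (∀ j ∈ J, ∀ z ∈ contexts J (wordsWith X' (k + 1)),
        z ∉ (bPart k P).coeff.support →
        CoeffGE (aPoly (L z).val * (va - 1) * aPoly (M j) + aPoly (L z).val) 0) := by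
  have hL : ∀ z, expPoly (fiber (z * bWord) P).support.val = fiber (z * bWord) P := by
    intro z
    ext t
    simp only [coeff_expPoly_val, mem_support_iff, coeff_fiber]
    rcases hP01 (z * bWord * aWord t) with h | h <;> simp [h]
  refine ⟨fun z => (fiber (z * bWord) P).support, ?_, fun z hz => ⟨?_, ?_⟩,
    fun j hj z hz hzP => ?_⟩
  · refine eq_of_fiber_eq ?_ fun z => ?_
    · rw [fiber_one_bPart_succ, fiber_one_sum_contexts]
    · rw [fiber_b_bPart_succ, fiber_b_sum_contexts, hL]
      by_cases hz : bCount z = k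
      · rw [if_pos hz]
        split_ifs with hQ
        · rfl
        · by_contra hne
          obtain ⟨j, hj, hjne⟩ := exists_bracket_ne_zero hP h0 h1 hne
          exact hQ (mem_contexts.2 ⟨hz, j, hj, (h.mem_iff hX' hz j).2 ⟨hj, hjne⟩⟩)
      · rw [if_neg hz, if_neg fun hQ => hz (mem_contexts.1 hQ).1]
  · exact coeffGE_add_aPoly_of_subset (Finset.filter_subset _ _) _
  · rw [coeffGE_aPoly_iff, hL, ← h.sum_bracket hX' (mem_contexts.1 hz).1]
    exact (codePoly_nonneg_iff.1 h0).2 z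
  · have hzk := (mem_contexts.1 hz).1
    rw [coeffGE_aPoly_iff, hL]
    have h2 := fiber_b_bracket (M j) P z
    have h3 : P.coeff z = 0 := by
      rw [Finsupp.notMem_support_iff, coeff_bPart, if_pos hzk] at hzP
      exact hzP
    rw [h3, C_0, zero_mul, add_zero] at h2
    rw [show fiber (z * bWord) P * (X - 1) * expPoly (M j) + fiber (z * bWord) P =
      fiber (z * bWord) (bracket (M j) P) by rw [h2]; ring]
    exact fun s => bracket_nonneg hP h0 h1 _ j hj

/-! ### From the code of `P'` to the code of `P` -/

theorem IsTruncation.codePoly_nonneg_of_exponents (h : IsTruncation k P P') (hP : CoeffGE P 0)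
    {X' : Finset Word} (hX' : charPoly X' = codePoly J M P') (h1 : (codePoly J M P').coeff 1 = 0)
    {L : Word → Finset ℕ}
    (hL : bPart (k + 1) P =
      ∑ z ∈ contexts J (wordsWith X' (k + 1)), mono z * vb * aPoly (L z).val)
    (hLJ : ∀ z ∈ contexts J (wordsWith X' (k + 1)),
      CoeffGE (aPoly (L z).val * (va - 1) * aPoly J.val +
        aPoly (rightExps J (wordsWith X' (k + 1)) z).val) 0)
    (hLJ' : ∀ z ∈ contexts J (wordsWith X' (k + 1)),
      CoeffGE (aPoly (L z).val * (va - 1) * aPoly J.val + aPoly J.val) 0)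
    (hLM : ∀ j ∈ J, ∀ z ∈ contexts J (wordsWith X' (k + 1)), z ∉ (bPart k P).coeff.support →
      CoeffGE (aPoly (L z).val * (va - 1) * aPoly (M j) + aPoly (L z).val) 0) :
    CoeffGE (codePoly J M P) 0 := by
  have h0 : CoeffGE (codePoly J M P') 0 := hX' ▸ charPoly_nonneg X'
  have h2 := codePoly_nonneg_iff.1 h0
  have hf : ∀ z, bCount z = k → fiber (z * bWord) P =
      if z ∈ contexts J (wordsWith X' (k + 1)) then expPoly (L z).val else 0 := by
    intro z hz
    rw [← fiber_b_sum_contexts, ← hL, fiber_b_bPart_succ, if_pos hz]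
  refine codePoly_nonneg_iff.2 ⟨by rw [← h.fiber_one]; exact h2.1, fun z => ?_⟩
  rcases lt_trichotomy (bCount z) k with hz | hz | hz
  · simp only [← h.bracket_eq hz.le, ← h.fiber_b hz]
    exact h2.2 z
  · rw [h.sum_bracket hX' hz, hf z hz]
    split_ifs with hQ
    · exact coeffGE_aPoly_iff.1 (hLJ z hQ)
    · rw [zero_mul, zero_mul, zero_add]
      exact expPoly_nonneg _
  rw [h.fiber_b_eq_zero_top hz, zero_mul, zero_mul, zero_add]
  refine nonnegCoeffs_sum_C_mul fun j hj => ?_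
  rcases eq_aWord_or_eq_mul_b_a z with ⟨s, rfl⟩ | ⟨y, s, rfl⟩
  · rw [bCount_aWord] at hz; omega
  rw [bCount_mul_b_a] at hz
  have hPy : 0 ≤ P.coeff y := hP y
  by_cases hy : k < bCount y
  · rw [coeff_bracket_b (h.fiber_b_eq_zero_top hy)]
    positivity
  have hyk : bCount y = k := by omega
  by_cases hQ : y ∈ contexts J (wordsWith X' (k + 1))
  swap
  · rw [coeff_bracket_b (by rw [hf y hyk, if_neg hQ])]
    positivity
  rw [← coeff_fiber, fiber_b_bracket, hf y hyk, if_pos hQ]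
  by_cases hyP : P.coeff y = 0
  · have h3 := coeffGE_aPoly_iff.1 (hLM j hj y hQ
      (by rw [Finsupp.notMem_support_iff, coeff_bPart, if_pos hyk, hyP])) s
    rw [hyP, C_0, zero_mul, add_zero]
    convert h3 using 2
    ring
  · -- The multiplicity of `y` in `P` is positive, so one copy of `a ^ {M_j}` is available for the
    -- composition principle.
    obtain ⟨hp, -, m, hm, hk⟩ := exists_krasner (h.nonneg hP) h0 h1
    have h4 : NonnegCoeffs (fiber 1 P' * (1 + (X - 1) * expPoly (M j))) := by
      rw [← fiber_one_bracket]
      exact fun t => bracket_nonneg (h.nonneg hP) h0 h1 _ j hj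
    have h5 := nonneg_comp_of_krasner hm hk (coeffGE_aPoly_iff.1 (hLJ' y hQ)) h4
    have h6 : NonnegCoeffs (C (P.coeff y - 1) * expPoly (M j)) := fun t => by
      rw [coeff_C_mul]
      exact mul_nonneg (by omega) (expPoly_nonneg _ t)
    have h7 := (h5.add h6) s
    convert h7 using 2
    rw [C_sub, C_1]
    ring

theorem IsTruncation.exists_code_of_exponents (h : IsTruncation k P P') (hP : CoeffGE P 0)
    (htop : bPart (k + 1) P ≠ 0) {X' : Finset Word} (hX : IsMCode (k + tIndex (bPart k P)) X')
    (hX' : charPoly X' = codePoly J M P') (h0 : CoeffGE (codePoly J M P) 0) :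
    ∃ X : Finset Word, IsMCode (k + 3) X ∧ IsPositiveFactorization P (krasnerS J M) X := by
  have h1 : (codePoly J M P').coeff 1 = 0 := hX' ▸ hX.coeff_one
  obtain ⟨X, hXP, hmax, hpos⟩ := exists_positiveFactorization (C := codePoly J M P) rfl
    hP (krasnerS_nonneg J M) h0 (h.coeff_one.symm.trans h1)
  refine ⟨X, IsMCode.of_coeff hXP hmax (fun w hw => coeff_codePoly_eq_zero (d := k + 2)
    (fun v hv => h.coeff_top v (by omega)) (by omega)) ?_, hpos⟩
  obtain ⟨w, hwX, hw⟩ := hX.2.2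
  obtain ⟨d, hd⟩ : ∃ d, k + tIndex (bPart k P) = d + 1 :=
    ⟨k + tIndex (bPart k P) - 1, by have := one_le_tIndex (bPart k P); omega⟩
  have hM : ∃ j ∈ J, M j ≠ 0 := exists_exponents_ne_zero (d := d) (w := w)
    (fun v hv => h.coeff_eq_zero (by omega)) (by omega)
    (by rw [← hX']; exact mem_iff_coeff_charPoly.1 hwX)
  obtain ⟨z, hz, hne⟩ := exists_coeff_ne_zero_of_bPart htop
  obtain ⟨u, hu, hune⟩ := exists_coeff_codePoly_ne_zero (z := z)
    (fun v hv => h.coeff_top v (by omega)) hne hM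
  exact ⟨u, by rw [hu, hz], hune⟩

end Truncation

theorem hasCoeffs01_of_positive {P S : NCPoly} (hP : CoeffGE P 0)
    (h : (HasCoeffs01 P ∧ HasCoeffs01 S) ∨ (HasCoeffs01 (-P) ∧ HasCoeffs01 (-S))) :
    HasCoeffs01 P := by
  rcases h with h | h
  · exact h.1
  · intro w
    have h1 := h.1 w
    have h2 : 0 ≤ P.coeff w := hP w
    simp only [MonoidAlgebra.coeff_neg, Finsupp.neg_apply] at h1
    omega

end FactorizingCodes

open FactorizingCodes
theorem mainTheorem5
    (n : ℕ) (I J : Finset ℕ) (hIJ : IsKrasner n I J)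
    (M : ℕ → Multiset ℕ) (S : NCPoly) (hS : S = krasnerS J M)
    (k : ℕ) (P P' : NCPoly) (hPnonneg : CoeffGE P 0)
    (hP' : P' = ∑ g ∈ Finset.range (k + 1), bPart g P)
    (hP : P = P' + bPart (k + 1) P) (hPtop : bPart (k + 1) P ≠ 0) :
    (∃ C : Finset Word, IsMCode (k + 3) C ∧ IsPositiveFactorization P S C)
    ↔
    (∃ C' : Finset Word,
        -- (1)
        IsMCode (k + tIndex (bPart k P)) C' ∧ IsPositiveFactorization P' S C' ∧
        ∃ L : Word → Finset ℕ,
          -- (2)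
          bPart (k + 1) P =
            ∑ z ∈ contexts J (wordsWith C' (k + 1)), mono z * vb * aPoly (L z).val ∧
          -- (3), first inequalities
          (∀ z ∈ contexts J (wordsWith C' (k + 1)),
            CoeffGE
              (aPoly (L z).val * (va - 1) * aPoly J.val + aPoly J.val)
              (aPoly (L z).val * (va - 1) * aPoly J.val +
                aPoly (rightExps J (wordsWith C' (k + 1)) z).val) ∧
            CoeffGE
              (aPoly (L z).val * (va - 1) * aPoly J.val +
                aPoly (rightExps J (wordsWith C' (k + 1)) z).val)
              0) ∧
          -- (3), second inequalities
          (∀ j ∈ J, ∀ z ∈ contexts J (wordsWith C' (k + 1)),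
            z ∉ (bPart k P).coeff.support →
            CoeffGE (aPoly (L z).val * (va - 1) * aPoly (M j) + aPoly (L z).val) 0)) := by
  have h := isTruncation_of_bPart hP' hP
  subst hS
  constructor
  · rintro ⟨X, hX, ⟨-, hXP⟩, hpos⟩
    have hXP' : charPoly X = codePoly J M P := hXP
    obtain ⟨X', hX', hcode, hpos'⟩ := h.exists_code hPnonneg hPtop hX hXP'
    exact ⟨X', hcode, hpos', h.exists_exponents hPnonneg (hasCoeffs01_of_positive hPnonneg hpos)
      (hXP' ▸ charPoly_nonneg X) (hXP' ▸ hX.coeff_one) hX'⟩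
  · rintro ⟨X', hcode, ⟨⟨-, hX⟩, -⟩, L, hL, hLJ, hLM⟩
    have hX' : charPoly X' = codePoly J M P' := hX
    exact h.exists_code_of_exponents hPnonneg hPtop hcode hX'
      (h.codePoly_nonneg_of_exponents hPnonneg hX' (hX' ▸ hcode.coeff_one) hL
        (fun z hz => (hLJ z hz).2) (fun z hz w => ((hLJ z hz).2 w).trans ((hLJ z hz).1 w)) hLM)
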